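/- Let $k\ge 0$ be an integer and let $M=\{M_\gamma\}_{\gamma\in\Gamma}$ be a defining family of functions on $\mathbb R^k$, i.e. a family of nonnegative Lebesgue measurable functions on $\mathbb R^k$, each bounded on every bounded subset of $\mathbb R^k$, such that (a) for all $\gamma_1,\gamma_2\in\Gamma$ there are $\gamma\in\Gamma$ and $C>0$ with $M_\gamma\ge C(M_{\gamma_1}+M_{\gamma_2})$; (b) there is a countable set $\Gamma'\subset\Gamma$ such that for every $\gamma\in\Gamma$ there are $\gamma'\in\Gamma'$ and $C>0$ with $CM_\gamma\le M_{\gamma'}$; (c) for every $x\in\mathbb R^k$ there are $\gamma\in\Gamma$, a neighbourhood $O(x)$ of $x$ and $C>0$ with $M_\gamma(x')\ge C$ for all $x'\in O(x)$. Let $\mathcal K(M)$ be the space of all smooth functions $f$ on $\mathbb R^k$ (with values in $\mathbb R$ or in $\mathbb C$, regarded as a linear space over the same field) for which the seminorms $$\|f\|_{\gamma,m}=\sup_{x\in\mathbb R^k,\ |\mu|\le m}M_\gamma(x)\,|\partial^\mu f(x)|,\qquad \gamma\in\Gamma,\ m\in\mathbb Z_+,$$ are all finite, with the topology determined by these seminorms.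 For real $p\ge 1$ let $\mathcal K_p(M)$ be the space of all smooth functions $f$ on $\mathbb R^k$ for which the seminorms $$\|f\|^p_{\gamma,m}=\left(\int_{\mathbb R^k}[M_\gamma(x)]^p\sum_{|\mu|\le m}|\partial^\mu f(x)|^p\,dx\right)^{1/p},\qquad \gamma\in\Gamma,\ m\in\mathbb Z_+,$$ are all finite, with the topology determined by these seminorms. Suppose that $M$ satisfies the following two conditions. (I) For every $\gamma\in\Gamma$ there are $\gamma'\in\Gamma$ and a summable nonnegative function $L_{\gamma\gamma'}$ on $\mathbb R^k$ such that $M_\gamma\le L_{\gamma\gamma'}M_{\gamma'}$ and $L_{\gamma\gamma'}(x)\to 0$ as $|x|\to\infty$. (II) For every $\gamma\in\Gamma$ there are $\gamma'\in\Gamma$, a neighbourhood $B$ of the origin in $\mathbb R^k$ and $C>0$ such that $M_\gamma(x)\le CM_{\gamma'}(x+y)$ for all $x\in\mathbb R^k$ and $y\in B$. Then $\mathcal K(M)$ is a nuclear Fréchet space, and for every real $p\ge 1$ it coincides with $\mathcal K_p(M)$ both as a set and topologically. -/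

import Mathlib

open MeasureTheory Filter Topology
open scoped ContDiff

/-! ### Partial derivatives with multi-indices

`ℝ^k` is realised as `Fin k → ℝ` with Lebesgue measure `volume`. The norm of `ℝ^k` only enters
through bounded sets, neighbourhoods, and limits at infinity, so any norm can be used. -/

/-- The multi-indices `μ ∈ ℤ₊^k` with `|μ| = μ₁ + … + μ_k ≤ m`. -/
def multiIndices (k m : ℕ) : Finset (Fin k → ℕ) :=
  (Fintype.piFinset fun _ => Finset.range (m + 1)).filter fun μ => ∑ i, μ i ≤ m

theorem mem_multiIndices {k m : ℕ} {μ : Fin k → ℕ} :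
    μ ∈ multiIndices k m ↔ ∑ i, μ i ≤ m := by
  simp only [multiIndices, Finset.mem_filter, Fintype.mem_piFinset, Finset.mem_range,
    and_iff_right_iff_imp]
  intro h i
  have := Finset.single_le_sum (f := μ) (fun j _ => Nat.zero_le _) (Finset.mem_univ i)
  omega

section Derivatives

variable {𝕜 : Type*} [RCLike 𝕜] {k : ℕ}

/-- The partial derivative `∂f/∂x_i`. -/
noncomputable def partialDeriv (i : Fin k) (f : (Fin k → ℝ) → 𝕜) : (Fin k → ℝ) → 𝕜 :=
  fun x => lineDeriv ℝ f x (Pi.single i 1)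

/-- `∂^μ f = ∂₁^{μ₁} ⋯ ∂_k^{μ_k} f`. -/
noncomputable def multiDeriv (μ : Fin k → ℕ) (f : (Fin k → ℝ) → 𝕜) : (Fin k → ℝ) → 𝕜 :=
  (List.finRange k).foldr (fun i g => (partialDeriv i)^[μ i] g) f

theorem partialDeriv_eq_fderiv (i : Fin k) {f : (Fin k → ℝ) → 𝕜} (hf : ContDiff ℝ ∞ f) :
    partialDeriv i f = fun x => fderiv ℝ f x (Pi.single i 1) := by
  funext x
  exact (hf.differentiable (by simp) x).lineDeriv_eq_fderiv

theorem contDiff_partialDeriv (i : Fin k) {f : (Fin k → ℝ) → 𝕜} (hf : ContDiff ℝ ∞ f) :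
    ContDiff ℝ ∞ (partialDeriv i f) := by
  rw [partialDeriv_eq_fderiv i hf]
  exact (hf.fderiv_right (m := ∞) (by simp)).clm_apply contDiff_const

theorem partialDeriv_add (i : Fin k) {f g : (Fin k → ℝ) → 𝕜} (hf : ContDiff ℝ ∞ f)
    (hg : ContDiff ℝ ∞ g) : partialDeriv i (f + g) = partialDeriv i f + partialDeriv i g := by
  rw [partialDeriv_eq_fderiv i hf, partialDeriv_eq_fderiv i hg,
    partialDeriv_eq_fderiv (f := f + g) i (hf.add hg)]
  funext x
  simp [fderiv_add (hf.differentiable (by simp) x) (hg.differentiable (by simp) x)]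

theorem partialDeriv_smul (i : Fin k) (c : 𝕜) {f : (Fin k → ℝ) → 𝕜} (hf : ContDiff ℝ ∞ f) :
    partialDeriv i (c • f) = c • partialDeriv i f := by
  rw [partialDeriv_eq_fderiv i hf, partialDeriv_eq_fderiv (f := c • f) i (hf.const_smul c)]
  funext x
  simp [fderiv_const_smul (hf.differentiable (by simp) x)]

theorem iterate_partialDeriv (i : Fin k) (n : ℕ) :
    (∀ f : (Fin k → ℝ) → 𝕜, ContDiff ℝ ∞ f → ContDiff ℝ ∞ ((partialDeriv i)^[n] f)) ∧
    (∀ f g : (Fin k → ℝ) → 𝕜, ContDiff ℝ ∞ f → ContDiff ℝ ∞ g →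
      (partialDeriv i)^[n] (f + g) = (partialDeriv i)^[n] f + (partialDeriv i)^[n] g) ∧
    (∀ (c : 𝕜) (f : (Fin k → ℝ) → 𝕜), ContDiff ℝ ∞ f →
      (partialDeriv i)^[n] (c • f) = c • (partialDeriv i)^[n] f) := by
  induction n with
  | zero => simp
  | succ n ih =>
    obtain ⟨h1, h2, h3⟩ := ih
    simp only [Function.iterate_succ_apply']
    refine ⟨fun f hf => contDiff_partialDeriv i (h1 f hf), fun f g hf hg => ?_,
      fun c f hf => ?_⟩
    · rw [h2 f g hf hg, partialDeriv_add i (h1 f hf) (h1 g hg)]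
    · rw [h3 c f hf, partialDeriv_smul i c (h1 f hf)]

theorem foldr_partialDeriv (μ : Fin k → ℕ) (l : List (Fin k)) :
    (∀ f : (Fin k → ℝ) → 𝕜, ContDiff ℝ ∞ f →
      ContDiff ℝ ∞ (l.foldr (fun i g => (partialDeriv i)^[μ i] g) f)) ∧
    (∀ f g : (Fin k → ℝ) → 𝕜, ContDiff ℝ ∞ f → ContDiff ℝ ∞ g →
      l.foldr (fun i g => (partialDeriv i)^[μ i] g) (f + g) =
        l.foldr (fun i g => (partialDeriv i)^[μ i] g) f +
        l.foldr (fun i g => (partialDeriv i)^[μ i] g) g) ∧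
    (∀ (c : 𝕜) (f : (Fin k → ℝ) → 𝕜), ContDiff ℝ ∞ f →
      l.foldr (fun i g => (partialDeriv i)^[μ i] g) (c • f) =
        c • l.foldr (fun i g => (partialDeriv i)^[μ i] g) f) := by
  induction l with
  | nil => simp
  | cons i l ih =>
    obtain ⟨h1, h2, h3⟩ := ih
    obtain ⟨k1, k2, k3⟩ := iterate_partialDeriv (𝕜 := 𝕜) i (μ i)
    simp only [List.foldr_cons]
    refine ⟨fun f hf => k1 _ (h1 f hf), fun f g hf hg => ?_, fun c f hf => ?_⟩
    · rw [h2 f g hf hg, k2 _ _ (h1 f hf) (h1 g hg)]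
    · rw [h3 c f hf, k3 _ _ (h1 f hf)]

theorem contDiff_multiDeriv (μ : Fin k → ℕ) {f : (Fin k → ℝ) → 𝕜} (hf : ContDiff ℝ ∞ f) :
    ContDiff ℝ ∞ (multiDeriv μ f) :=
  (foldr_partialDeriv μ _).1 f hf

theorem multiDeriv_add (μ : Fin k → ℕ) {f g : (Fin k → ℝ) → 𝕜} (hf : ContDiff ℝ ∞ f)
    (hg : ContDiff ℝ ∞ g) : multiDeriv μ (f + g) = multiDeriv μ f + multiDeriv μ g :=
  (foldr_partialDeriv μ _).2.1 f g hf hg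

theorem multiDeriv_smul (μ : Fin k → ℕ) (c : 𝕜) {f : (Fin k → ℝ) → 𝕜} (hf : ContDiff ℝ ∞ f) :
    multiDeriv μ (c • f) = c • multiDeriv μ f :=
  (foldr_partialDeriv μ _).2.2 c f hf

theorem multiDeriv_zero (μ : Fin k → ℕ) : multiDeriv μ (0 : (Fin k → ℝ) → 𝕜) = 0 := by
  have h := multiDeriv_smul μ (0 : 𝕜) (f := (0 : (Fin k → ℝ) → 𝕜)) contDiff_const
  simpa using h

end Derivatives

/-! ### Defining families -/

/-- A defining family `M = {M_γ}` of functions on `ℝ^k`. Measurability is Lebesgue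
measurability, which is `AEMeasurable` with respect to `volume`. -/
structure DefiningFamily (k : ℕ) (Γ : Type*) where
  toFun : Γ → (Fin k → ℝ) → ℝ
  nonneg : ∀ γ x, 0 ≤ toFun γ x
  measurable : ∀ γ, AEMeasurable (toFun γ) volume
  locallyBounded : ∀ (γ : Γ) (s : Set (Fin k → ℝ)), Bornology.IsBounded s →
    ∃ C : ℝ, ∀ x ∈ s, toFun γ x ≤ C
  directed : ∀ γ₁ γ₂ : Γ, ∃ (γ : Γ) (C : ℝ), 0 < C ∧
    ∀ x, C * (toFun γ₁ x + toFun γ₂ x) ≤ toFun γ x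
  countable_cofinal : ∃ Γ' : Set Γ, Γ'.Countable ∧
    ∀ γ : Γ, ∃ γ' ∈ Γ', ∃ C : ℝ, 0 < C ∧ ∀ x, C * toFun γ x ≤ toFun γ' x
  locally_pos : ∀ x : Fin k → ℝ, ∃ γ : Γ, ∃ U ∈ 𝓝 x, ∃ C : ℝ, 0 < C ∧
    ∀ x' ∈ U, C ≤ toFun γ x'

instance {k : ℕ} {Γ : Type*} : CoeFun (DefiningFamily k Γ) fun _ => Γ → (Fin k → ℝ) → ℝ :=
  ⟨DefiningFamily.toFun⟩

namespace DefiningFamily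

variable {k : ℕ} {Γ : Type*}

/-- Condition (I): for every `γ` there are `γ'` and a summable nonnegative function `L` tending to
`0` at infinity with `M_γ ≤ L M_γ'`. -/
def CondI (M : DefiningFamily k Γ) : Prop :=
  ∀ γ : Γ, ∃ (γ' : Γ) (L : (Fin k → ℝ) → ℝ), (∀ x, 0 ≤ L x) ∧ Integrable L volume ∧
    Tendsto L (cocompact (Fin k → ℝ)) (𝓝 0) ∧ ∀ x, M γ x ≤ L x * M γ' x

/-- Condition (II): for every `γ` there are `γ'`, a neighbourhood `B` of the origin and `C > 0`
with `M_γ(x) ≤ C M_γ'(x + y)` for all `x ∈ ℝ^k`, `y ∈ B`. -/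
def CondII (M : DefiningFamily k Γ) : Prop :=
  ∀ γ : Γ, ∃ γ' : Γ, ∃ B ∈ 𝓝 (0 : Fin k → ℝ), ∃ C : ℝ, 0 < C ∧
    ∀ x, ∀ y ∈ B, M γ x ≤ C * M γ' (x + y)

end DefiningFamily

/-! ### The space `K(M)` -/

section KSpace

variable (𝕜 : Type*) [RCLike 𝕜] {k : ℕ} {Γ : Type*} (M : DefiningFamily k Γ)

/-- The quantity `‖f‖_{γ,m} = sup_{x, |μ| ≤ m} M_γ(x) |∂^μ f(x)|`. -/
noncomputable def supNorm {𝕜 : Type*} [RCLike 𝕜] (γ : Γ) (m : ℕ) (f : (Fin k → ℝ) → 𝕜) : ℝ :=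
  ⨆ q : (Fin k → ℝ) × multiIndices k m, M γ q.1 * ‖multiDeriv q.2.1 f q.1‖

/-- The quantity `‖f‖_{γ,m}` is finite. -/
def SupNormFinite {𝕜 : Type*} [RCLike 𝕜] (γ : Γ) (m : ℕ) (f : (Fin k → ℝ) → 𝕜) : Prop :=
  BddAbove (Set.range fun q : (Fin k → ℝ) × multiIndices k m =>
    M γ q.1 * ‖multiDeriv q.2.1 f q.1‖)

instance multiIndices_nonempty (k m : ℕ) : Nonempty (multiIndices k m) :=
  ⟨⟨0, mem_multiIndices.2 (by simp)⟩⟩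

variable {𝕜 M} in
theorem SupNormFinite.add {γ : Γ} {m : ℕ} {f g : (Fin k → ℝ) → 𝕜} (hf : ContDiff ℝ ∞ f)
    (hg : ContDiff ℝ ∞ g) (hf' : SupNormFinite M γ m f) (hg' : SupNormFinite M γ m g) :
    SupNormFinite M γ m (f + g) ∧ supNorm M γ m (f + g) ≤ supNorm M γ m f + supNorm M γ m g := by
  have key : ∀ q : (Fin k → ℝ) × multiIndices k m,
      M γ q.1 * ‖multiDeriv q.2.1 (f + g) q.1‖ ≤ supNorm M γ m f + supNorm M γ m g := by
    intro q
    have h1 : M γ q.1 * ‖multiDeriv q.2.1 f q.1‖ ≤ supNorm M γ m f := le_ciSup hf' q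
    have h2 : M γ q.1 * ‖multiDeriv q.2.1 g q.1‖ ≤ supNorm M γ m g := le_ciSup hg' q
    rw [multiDeriv_add _ hf hg, Pi.add_apply]
    calc _ ≤ M γ q.1 * (‖multiDeriv q.2.1 f q.1‖ + ‖multiDeriv q.2.1 g q.1‖) :=
          mul_le_mul_of_nonneg_left (norm_add_le _ _) (M.nonneg _ _)
      _ ≤ _ := by linarith
  exact ⟨⟨_, by rintro _ ⟨q, rfl⟩; exact key q⟩, ciSup_le key⟩

variable {𝕜 M} in
theorem SupNormFinite.smul {γ : Γ} {m : ℕ} (c : 𝕜) {f : (Fin k → ℝ) → 𝕜} (hf : ContDiff ℝ ∞ f)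
    (hf' : SupNormFinite M γ m f) :
    SupNormFinite M γ m (c • f) ∧ supNorm M γ m (c • f) = ‖c‖ * supNorm M γ m f := by
  have key : ∀ q : (Fin k → ℝ) × multiIndices k m,
      M γ q.1 * ‖multiDeriv q.2.1 (c • f) q.1‖ = ‖c‖ * (M γ q.1 * ‖multiDeriv q.2.1 f q.1‖) := by
    intro q
    rw [multiDeriv_smul _ c hf, Pi.smul_apply, norm_smul]
    ring
  constructor
  · refine ⟨‖c‖ * supNorm M γ m f, ?_⟩
    rintro _ ⟨q, rfl⟩
    simp only [key]
    exact mul_le_mul_of_nonneg_left (le_ciSup hf' q) (norm_nonneg _)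
  · simp only [supNorm, key]
    exact (Real.mul_iSup_of_nonneg (norm_nonneg _) _).symm

variable {𝕜 M} in
theorem supNorm_zero (γ : Γ) (m : ℕ) :
    SupNormFinite M γ m (0 : (Fin k → ℝ) → 𝕜) ∧ supNorm M γ m (0 : (Fin k → ℝ) → 𝕜) = 0 := by
  constructor
  · refine ⟨0, ?_⟩
    rintro _ ⟨q, rfl⟩
    simp [multiDeriv_zero]
  · simp [supNorm, multiDeriv_zero]

/-- `K(M)` as a linear space: all smooth `f : ℝ^k → 𝕜` with `‖f‖_{γ,m} < ∞` for all `γ, m`. -/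
def KSubmodule : Submodule 𝕜 ((Fin k → ℝ) → 𝕜) where
  carrier := {f | ContDiff ℝ ∞ f ∧ ∀ γ m, SupNormFinite M γ m f}
  add_mem' hf hg := ⟨hf.1.add hg.1, fun γ m => ((hf.2 γ m).add hf.1 hg.1 (hg.2 γ m)).1⟩
  zero_mem' := ⟨contDiff_const, fun γ m => (supNorm_zero γ m).1⟩
  smul_mem' c _ hf := ⟨hf.1.const_smul c, fun γ m => ((hf.2 γ m).smul c hf.1).1⟩

/-- The space `K(M)`. It is a separate type, so that it does not inherit the topology of pointwise
convergence. -/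
def KSpace : Type _ := KSubmodule 𝕜 M

noncomputable instance : AddCommGroup (KSpace 𝕜 M) :=
  inferInstanceAs (AddCommGroup (KSubmodule 𝕜 M))

noncomputable instance : Module 𝕜 (KSpace 𝕜 M) :=
  inferInstanceAs (Module 𝕜 (KSubmodule 𝕜 M))

/-- The function underlying an element of `K(M)`. -/
def KSpace.toFun {𝕜 : Type*} [RCLike 𝕜] {M : DefiningFamily k Γ} (f : KSpace 𝕜 M) :
    (Fin k → ℝ) → 𝕜 :=
  Subtype.val (p := fun g => g ∈ KSubmodule 𝕜 M) f

/-- The seminorms `‖·‖_{γ,m}` on `K(M)`. -/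
noncomputable def kSeminorm : SeminormFamily 𝕜 (KSpace 𝕜 M) (Γ × ℕ) := fun i =>
  Seminorm.of (fun f => supNorm M i.1 i.2 f.toFun)
    (fun f g => ((f.2.2 i.1 i.2).add f.2.1 g.2.1 (g.2.2 i.1 i.2)).2)
    (fun c f => ((f.2.2 i.1 i.2).smul c f.2.1).2)

/-- The (uniform) topology of `K(M)` determined by the seminorms `‖·‖_{γ,m}`. -/
noncomputable instance : UniformSpace (KSpace 𝕜 M) :=
  (kSeminorm 𝕜 M).moduleFilterBasis.toAddGroupFilterBasis.uniformSpace

instance : IsUniformAddGroup (KSpace 𝕜 M) :=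
  (kSeminorm 𝕜 M).moduleFilterBasis.toAddGroupFilterBasis.isUniformAddGroup

theorem kSpace_withSeminorms : WithSeminorms (kSeminorm 𝕜 M) := ⟨rfl⟩

end KSpace

/-! ### The spaces `K_p(M)` -/

section KpSpace

variable (𝕜 : Type*) [RCLike 𝕜] {k : ℕ} {Γ : Type*} (M : DefiningFamily k Γ)
  {p : ℝ} (hp : 1 ≤ p)

/-- The function `[M_γ(x)]^p ∑_{|μ| ≤ m} |∂^μ f(x)|^p`. -/
noncomputable def kpIntegrand {𝕜 : Type*} [RCLike 𝕜] (p : ℝ) (γ : Γ) (m : ℕ)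
    (f : (Fin k → ℝ) → 𝕜) (x : Fin k → ℝ) : ℝ :=
  M γ x ^ p * ∑ μ ∈ multiIndices k m, ‖multiDeriv μ f x‖ ^ p

/-- The quantity `‖f‖^p_{γ,m} = (∫ [M_γ(x)]^p ∑_{|μ| ≤ m} |∂^μ f(x)|^p dx)^{1/p}` (here `p` is an
upper index). -/
noncomputable def kpNorm {𝕜 : Type*} [RCLike 𝕜] (p : ℝ) (γ : Γ) (m : ℕ)
    (f : (Fin k → ℝ) → 𝕜) : ℝ :=
  (∫ x, kpIntegrand M p γ m f x) ^ (1 / p)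

theorem kpIntegrand_nonneg {𝕜 : Type*} [RCLike 𝕜] (p : ℝ) (γ : Γ) (m : ℕ)
    (f : (Fin k → ℝ) → 𝕜) (x : Fin k → ℝ) : 0 ≤ kpIntegrand M p γ m f x :=
  mul_nonneg (Real.rpow_nonneg (M.nonneg _ _) _)
    (Finset.sum_nonneg fun _ _ => Real.rpow_nonneg (norm_nonneg _) _)

theorem aemeasurable_kpIntegrand {𝕜 : Type*} [RCLike 𝕜] (p : ℝ) (γ : Γ) (m : ℕ)
    {f : (Fin k → ℝ) → 𝕜} (hf : ContDiff ℝ ∞ f) : AEMeasurable (kpIntegrand M p γ m f) := by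
  refine ((M.measurable γ).pow_const p).mul (Measurable.aemeasurable ?_)
  refine Finset.measurable_sum _ fun μ _ => ?_
  exact (contDiff_multiDeriv μ hf).continuous.norm.measurable.pow_const p

theorem kpIntegrand_memLp {𝕜 : Type*} [RCLike 𝕜] {p : ℝ} (hp : 1 ≤ p) {γ : Γ} {m : ℕ} {f : (Fin k → ℝ) → 𝕜}
    (hf : ContDiff ℝ ∞ f) (hf' : Integrable (kpIntegrand M p γ m f)) :
    MemLp (fun x => kpIntegrand M p γ m f x ^ (1 / p)) (ENNReal.ofReal p) ∧
    eLpNorm (fun x => kpIntegrand M p γ m f x ^ (1 / p)) (ENNReal.ofReal p) volume =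
      ENNReal.ofReal (kpNorm M p γ m f) := by
  have hp0 : 0 < p := by linarith
  have heq : ∀ x, ‖kpIntegrand M p γ m f x ^ (1 / p)‖ ^ p = kpIntegrand M p γ m f x := by
    intro x
    have h0 := kpIntegrand_nonneg M p γ m f x
    rw [Real.norm_of_nonneg (Real.rpow_nonneg h0 _), ← Real.rpow_mul h0,
      one_div_mul_cancel hp0.ne', Real.rpow_one]
  have hmem : MemLp (fun x => kpIntegrand M p γ m f x ^ (1 / p)) (ENNReal.ofReal p) := by
    rw [← integrable_norm_rpow_iff
      ((aemeasurable_kpIntegrand M p γ m hf).pow_const _).aestronglyMeasurable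
      (by simpa using hp0) (by simp), ENNReal.toReal_ofReal hp0.le]
    simpa only [heq] using hf'
  refine ⟨hmem, ?_⟩
  rw [hmem.eLpNorm_eq_integral_rpow_norm (by simpa using hp0) (by simp),
    ENNReal.toReal_ofReal hp0.le]
  simp only [heq, kpNorm]
  rw [one_div]

variable {M} in
theorem kpNorm_add {𝕜 : Type*} [RCLike 𝕜] {p : ℝ} (hp : 1 ≤ p) {γ : Γ} {m : ℕ} {f g : (Fin k → ℝ) → 𝕜}
    (hf : ContDiff ℝ ∞ f) (hg : ContDiff ℝ ∞ g) (hf' : Integrable (kpIntegrand M p γ m f))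
    (hg' : Integrable (kpIntegrand M p γ m g)) :
    Integrable (kpIntegrand M p γ m (f + g)) ∧
      kpNorm M p γ m (f + g) ≤ kpNorm M p γ m f + kpNorm M p γ m g := by
  have hp0 : 0 < p := by linarith
  have root : ∀ (u : (Fin k → ℝ) → 𝕜) x, kpIntegrand M p γ m u x ^ (1 / p) =
      M γ x * (∑ μ ∈ multiIndices k m, ‖multiDeriv μ u x‖ ^ p) ^ (1 / p) := by
    intro u x
    rw [kpIntegrand, Real.mul_rpow (Real.rpow_nonneg (M.nonneg _ _) _)
      (Finset.sum_nonneg fun _ _ => Real.rpow_nonneg (norm_nonneg _) _),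
      ← Real.rpow_mul (M.nonneg _ _), mul_one_div_cancel hp0.ne', Real.rpow_one]
  have tri : ∀ x, kpIntegrand M p γ m (f + g) x ^ (1 / p) ≤
      kpIntegrand M p γ m f x ^ (1 / p) + kpIntegrand M p γ m g x ^ (1 / p) := by
    intro x
    rw [root, root, root, ← mul_add]
    refine mul_le_mul_of_nonneg_left ?_ (M.nonneg _ _)
    refine le_trans ?_ (Real.Lp_add_le_of_nonneg _ hp (fun _ _ => norm_nonneg _)
      (fun _ _ => norm_nonneg _))
    refine Real.rpow_le_rpow
      (Finset.sum_nonneg fun _ _ => Real.rpow_nonneg (norm_nonneg _) _) ?_ (by positivity)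
    refine Finset.sum_le_sum fun μ _ => Real.rpow_le_rpow (norm_nonneg _) ?_ hp0.le
    rw [multiDeriv_add μ hf hg]
    exact norm_add_le _ _
  obtain ⟨mf, ef⟩ := kpIntegrand_memLp M hp hf hf'
  obtain ⟨mg, eg⟩ := kpIntegrand_memLp M hp hg hg'
  have nn : ∀ (u : (Fin k → ℝ) → 𝕜) x, 0 ≤ kpIntegrand M p γ m u x ^ (1 / p) := fun u x =>
    Real.rpow_nonneg (kpIntegrand_nonneg M p γ m u x) _
  have tri' : ∀ x, ‖kpIntegrand M p γ m (f + g) x ^ (1 / p)‖ ≤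
      ‖kpIntegrand M p γ m f x ^ (1 / p) + kpIntegrand M p γ m g x ^ (1 / p)‖ := by
    intro x
    rw [Real.norm_of_nonneg (nn _ x), Real.norm_of_nonneg (add_nonneg (nn _ x) (nn _ x))]
    exact tri x
  have msum : AEStronglyMeasurable (fun x => kpIntegrand M p γ m (f + g) x ^ (1 / p)) volume :=
    ((aemeasurable_kpIntegrand M p γ m (hf.add hg)).pow_const _).aestronglyMeasurable
  have mfg := (mf.add mg).mono msum (ae_of_all _ tri')
  have ifg : Integrable (kpIntegrand M p γ m (f + g)) := by
    have := (integrable_norm_rpow_iff msum (p := ENNReal.ofReal p)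
      (by simpa using hp0) (by simp)).2 mfg
    rw [ENNReal.toReal_ofReal hp0.le] at this
    refine this.congr (ae_of_all _ fun x => ?_)
    have h0 := kpIntegrand_nonneg M p γ m (f + g) x
    simp only
    rw [Real.norm_of_nonneg (nn _ x), ← Real.rpow_mul h0, one_div_mul_cancel hp0.ne',
      Real.rpow_one]
  refine ⟨ifg, ?_⟩
  have kn : ∀ u : (Fin k → ℝ) → 𝕜, 0 ≤ kpNorm M p γ m u := fun u =>
    Real.rpow_nonneg (integral_nonneg (kpIntegrand_nonneg M p γ m u)) _
  have h1 : eLpNorm (fun x => kpIntegrand M p γ m (f + g) x ^ (1 / p)) (ENNReal.ofReal p) volume ≤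
      ENNReal.ofReal (kpNorm M p γ m f) + ENNReal.ofReal (kpNorm M p γ m g) := by
    rw [← ef, ← eg]
    exact (eLpNorm_mono tri').trans (eLpNorm_add_le mf.1 mg.1 (by simpa using hp))
  rw [(kpIntegrand_memLp M hp (f := f + g) (hf.add hg) ifg).2, ← ENNReal.ofReal_add (kn f) (kn g),
    ENNReal.ofReal_le_ofReal_iff (add_nonneg (kn f) (kn g))] at h1
  exact h1

variable {M} in
theorem kpNorm_smul {𝕜 : Type*} [RCLike 𝕜] {p : ℝ} (hp : 1 ≤ p) {γ : Γ} {m : ℕ} (c : 𝕜) {f : (Fin k → ℝ) → 𝕜}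
    (hf : ContDiff ℝ ∞ f) (hf' : Integrable (kpIntegrand M p γ m f)) :
    Integrable (kpIntegrand M p γ m (c • f)) ∧
      kpNorm M p γ m (c • f) = ‖c‖ * kpNorm M p γ m f := by
  have hp0 : 0 < p := by linarith
  have key : kpIntegrand M p γ m (c • f) = fun x => ‖c‖ ^ p * kpIntegrand M p γ m f x := by
    funext x
    simp only [kpIntegrand, multiDeriv_smul _ c hf, Pi.smul_apply, norm_smul,
      Real.mul_rpow (norm_nonneg _) (norm_nonneg _), ← Finset.mul_sum]
    ring
  refine ⟨by rw [key]; exact hf'.const_mul _, ?_⟩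
  simp only [kpNorm, key, integral_const_mul]
  rw [Real.mul_rpow (Real.rpow_nonneg (norm_nonneg _) _)
    (integral_nonneg (kpIntegrand_nonneg M p γ m f)), ← Real.rpow_mul (norm_nonneg _),
    mul_one_div_cancel hp0.ne', Real.rpow_one]

variable {M} in
theorem integrable_kpIntegrand_zero {𝕜 : Type*} [RCLike 𝕜] {p : ℝ} (hp : 1 ≤ p) (γ : Γ) (m : ℕ) :
    Integrable (kpIntegrand M p γ m (0 : (Fin k → ℝ) → 𝕜)) := by
  have hp0 : p ≠ 0 := by linarith
  have : kpIntegrand M p γ m (0 : (Fin k → ℝ) → 𝕜) = 0 := by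
    funext x
    simp [kpIntegrand, multiDeriv_zero, Real.zero_rpow hp0]
  rw [this]
  exact integrable_zero _ _ _

/-- `K_p(M)` as a linear space: all smooth `f : ℝ^k → 𝕜` with `‖f‖^p_{γ,m} < ∞` for all
`γ, m`. -/
def KpSubmodule : Submodule 𝕜 ((Fin k → ℝ) → 𝕜) where
  carrier := {f | ContDiff ℝ ∞ f ∧ ∀ γ m, Integrable (kpIntegrand M p γ m f) volume}
  add_mem' hf hg := ⟨hf.1.add hg.1, fun γ m => (kpNorm_add hp hf.1 hg.1 (hf.2 γ m) (hg.2 γ m)).1⟩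
  zero_mem' := ⟨contDiff_const, fun γ m => integrable_kpIntegrand_zero hp γ m⟩
  smul_mem' c _ hf := ⟨hf.1.const_smul c, fun γ m => (kpNorm_smul hp c hf.1 (hf.2 γ m)).1⟩

/-- The space `K_p(M)`, `p ≥ 1`. -/
def KpSpace : Type _ := KpSubmodule 𝕜 M hp

noncomputable instance : AddCommGroup (KpSpace 𝕜 M hp) :=
  inferInstanceAs (AddCommGroup (KpSubmodule 𝕜 M hp))

noncomputable instance : Module 𝕜 (KpSpace 𝕜 M hp) :=
  inferInstanceAs (Module 𝕜 (KpSubmodule 𝕜 M hp))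

/-- The function underlying an element of `K_p(M)`. -/
def KpSpace.toFun {𝕜 : Type*} [RCLike 𝕜] {M : DefiningFamily k Γ} {p : ℝ} {hp : 1 ≤ p}
    (f : KpSpace 𝕜 M hp) : (Fin k → ℝ) → 𝕜 :=
  Subtype.val (p := fun g => g ∈ KpSubmodule 𝕜 M hp) f

/-- The seminorms `‖·‖^p_{γ,m}` on `K_p(M)`. -/
noncomputable def kpSeminorm : SeminormFamily 𝕜 (KpSpace 𝕜 M hp) (Γ × ℕ) := fun i =>
  Seminorm.of (fun f => kpNorm M p i.1 i.2 f.toFun)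
    (fun f g => (kpNorm_add hp f.2.1 g.2.1 (f.2.2 i.1 i.2) (g.2.2 i.1 i.2)).2)
    (fun c f => (kpNorm_smul hp c f.2.1 (f.2.2 i.1 i.2)).2)

/-- The (uniform) topology of `K_p(M)` determined by the seminorms `‖·‖^p_{γ,m}`. -/
noncomputable instance : UniformSpace (KpSpace 𝕜 M hp) :=
  (kpSeminorm 𝕜 M hp).moduleFilterBasis.toAddGroupFilterBasis.uniformSpace

instance : IsUniformAddGroup (KpSpace 𝕜 M hp) :=
  (kpSeminorm 𝕜 M hp).moduleFilterBasis.toAddGroupFilterBasis.isUniformAddGroup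

theorem kpSpace_withSeminorms : WithSeminorms (kpSeminorm 𝕜 M hp) := ⟨rfl⟩

end KpSpace

/-! ### Fréchet spaces and nuclear spaces -/

section LCS

variable {𝕜 : Type*} [RCLike 𝕜] {F : Type*} [AddCommGroup F] [Module 𝕜 F]

/-- `F` with the seminorm `p` as its only seminorm. -/
def SeminormedBy (_p : Seminorm 𝕜 F) : Type _ := F

noncomputable instance (p : Seminorm 𝕜 F) : SeminormedAddCommGroup (SeminormedBy p) :=
  p.toAddGroupSeminorm.toSeminormedAddCommGroup

noncomputable instance (p : Seminorm 𝕜 F) : Module 𝕜 (SeminormedBy p) :=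
  inferInstanceAs (Module 𝕜 F)

noncomputable instance (p : Seminorm 𝕜 F) : NormedSpace 𝕜 (SeminormedBy p) where
  norm_smul_le c x := (map_smul_eq_mul p c x).le

/-- The local Banach space `F_p`: the Hausdorff completion of `F` with respect to `p`. -/
abbrev LocalBanachSpace (p : Seminorm 𝕜 F) : Type _ :=
  UniformSpace.Completion (SeminormedBy p)

/-- For `p ≤ q`, the identity of `F` as a continuous map from `(F, q)` to `(F, p)`. -/
noncomputable def seminormedByMap {p q : Seminorm 𝕜 F} (h : p ≤ q) :
    SeminormedBy q →L[𝕜] SeminormedBy p :=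
  LinearMap.mkContinuous
    ({ toFun := fun x => x
       map_add' := fun _ _ => rfl
       map_smul' := fun _ _ => rfl } : SeminormedBy q →ₗ[𝕜] SeminormedBy p) 1
    (fun x => (h x).trans_eq (one_mul _).symm)

/-- For `p ≤ q`, the canonical map `F_q → F_p` of local Banach spaces. -/
noncomputable def localBanachMap {p q : Seminorm 𝕜 F} (h : p ≤ q) :
    LocalBanachSpace q →L[𝕜] LocalBanachSpace p :=
  (seminormedByMap h).completion

/-- A continuous linear map between Banach spaces is nuclear if it has the form
`T x = ∑ φ_n(x) y_n` with `∑ ‖φ_n‖ ‖y_n‖ < ∞`. -/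
def IsNuclearMap {X Y : Type*} [NormedAddCommGroup X] [NormedSpace 𝕜 X] [NormedAddCommGroup Y]
    [NormedSpace 𝕜 Y] (T : X →L[𝕜] Y) : Prop :=
  ∃ (φ : ℕ → X →L[𝕜] 𝕜) (y : ℕ → Y), (Summable fun n => ‖φ n‖ * ‖y n‖) ∧
    ∀ x, HasSum (fun n => φ n x • y n) (T x)

variable (𝕜 F)

/-- A nuclear space: a locally convex space such that for every continuous seminorm `p` there is a
continuous seminorm `q ≥ p` for which the canonical map `F_q → F_p` of local Banach spaces is
nuclear. Over `ℝ` or `ℂ`, `PolynormableSpace` is local convexity. -/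
structure IsNuclearSpace [TopologicalSpace F] : Prop where
  locallyConvex : PolynormableSpace 𝕜 F
  nuclear : ∀ p : Seminorm 𝕜 F, Continuous p →
    ∃ (q : Seminorm 𝕜 F) (h : p ≤ q), Continuous q ∧ IsNuclearMap (localBanachMap h)

/-- A Fréchet space: a locally convex topological vector space that is Hausdorff, has a countable
base of neighbourhoods of the origin (so it is metrizable), and is complete. -/
structure IsFrechetSpace [UniformSpace F] : Prop where
  isUniformAddGroup : IsUniformAddGroup F
  continuousSMul : ContinuousSMul 𝕜 F
  locallyConvex : PolynormableSpace 𝕜 F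
  hausdorff : T2Space F
  countable_basis : (𝓝 (0 : F)).IsCountablyGenerated
  complete : CompleteSpace F

end LCS

/-! ### Calculus of multi-index derivatives -/

section MultiIndexCalculus

variable {𝕜 : Type*} [RCLike 𝕜] {k : ℕ}

theorem partialDeriv_comm (i j : Fin k) {f : (Fin k → ℝ) → 𝕜} (hf : ContDiff ℝ ∞ f) :
    partialDeriv i (partialDeriv j f) = partialDeriv j (partialDeriv i f) := by
  have key : ∀ a b : Fin k, ∀ x, partialDeriv a (partialDeriv b f) x =
      fderiv ℝ (fderiv ℝ f) x (Pi.single a 1) (Pi.single b 1) := by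
    intro a b x
    rw [partialDeriv_eq_fderiv a (contDiff_partialDeriv b hf), partialDeriv_eq_fderiv b hf]
    have hd : DifferentiableAt ℝ (fderiv ℝ f) x :=
      (hf.fderiv_right (m := ∞) (by simp)).differentiable (by simp) x
    simp only
    rw [fderiv_clm_apply hd (differentiableAt_const _)]
    simp
  funext x
  rw [key, key]
  exact (hf.contDiffAt.isSymmSndFDerivAt (by
    rw [minSmoothness_of_isRCLikeNormedField]
    exact WithTop.coe_le_coe.2 le_top)) _ _

theorem partialDeriv_iterate_comm (i j : Fin k) (n : ℕ) {f : (Fin k → ℝ) → 𝕜}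
    (hf : ContDiff ℝ ∞ f) :
    partialDeriv i ((partialDeriv j)^[n] f) = (partialDeriv j)^[n] (partialDeriv i f) := by
  induction n with
  | zero => rfl
  | succ n ih =>
    rw [Function.iterate_succ_apply', Function.iterate_succ_apply', ← ih,
      partialDeriv_comm i j ((iterate_partialDeriv j n).1 f hf)]

theorem foldr_partialDeriv_congr {μ ν : Fin k → ℕ} (l : List (Fin k)) (h : ∀ i ∈ l, μ i = ν i)
    (f : (Fin k → ℝ) → 𝕜) :
    l.foldr (fun i g => (partialDeriv i)^[μ i] g) f =
      l.foldr (fun i g => (partialDeriv i)^[ν i] g) f := by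
  induction l with
  | nil => rfl
  | cons j l ih =>
    simp only [List.foldr_cons]
    rw [h j (by simp), ih fun i hi => h i (by simp [hi])]

/-- A derivative in direction `i` commutes past the blocks of the other coordinates until it meets
its own and raises that exponent. Absence of repetitions guarantees that only one block changes. -/
theorem partialDeriv_foldr (i : Fin k) (μ : Fin k → ℕ) (l : List (Fin k)) (hl : l.Nodup)
    (hi : i ∈ l) {f : (Fin k → ℝ) → 𝕜} (hf : ContDiff ℝ ∞ f) :
    partialDeriv i (l.foldr (fun i g => (partialDeriv i)^[μ i] g) f) =
      l.foldr (fun j g => (partialDeriv j)^[(μ + Pi.single i 1 : Fin k → ℕ) j] g) f := by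
  induction l with
  | nil => simp at hi
  | cons j l ih =>
    simp only [List.foldr_cons]
    rw [List.nodup_cons] at hl
    by_cases hij : i = j
    · subst hij
      rw [← foldr_partialDeriv_congr (μ := μ) (ν := μ + Pi.single i 1) l (fun a ha => by
        have : a ≠ i := fun h => hl.1 (h ▸ ha)
        simp [this])]
      simp [Function.iterate_succ_apply']
    · rw [partialDeriv_iterate_comm i j _ ((foldr_partialDeriv μ l).1 f hf),
        ih hl.2 ((List.mem_cons.1 hi).resolve_left hij)]
      have : j ≠ i := fun h => hij h.symm
      simp [this]

theorem partialDeriv_multiDeriv (i : Fin k) (μ : Fin k → ℕ) {f : (Fin k → ℝ) → 𝕜}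
    (hf : ContDiff ℝ ∞ f) :
    partialDeriv i (multiDeriv μ f) = multiDeriv (μ + Pi.single i 1) f :=
  partialDeriv_foldr i μ _ (List.nodup_finRange k) (List.mem_finRange i) hf

theorem multiDeriv_zero_index (f : (Fin k → ℝ) → 𝕜) : multiDeriv 0 f = f := by
  rw [multiDeriv]
  induction List.finRange k with
  | nil => rfl
  | cons i l ih => simp

theorem multiDeriv_sum {ι : Type*} (s : Finset ι) (μ : Fin k → ℕ) (a : ι → 𝕜)
    (f : ι → (Fin k → ℝ) → 𝕜) (hf : ∀ j, ContDiff ℝ ∞ (f j)) :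
    ContDiff ℝ ∞ (∑ j ∈ s, a j • f j) ∧
      multiDeriv μ (∑ j ∈ s, a j • f j) = ∑ j ∈ s, a j • multiDeriv μ (f j) := by
  classical
  induction s using Finset.induction_on with
  | empty => exact ⟨by rw [Finset.sum_empty]; exact contDiff_const, by simpa using multiDeriv_zero μ⟩
  | insert j s hj ih =>
    have hj' : ContDiff ℝ ∞ (a j • f j) := (hf j).const_smul (a j)
    simp only [Finset.sum_insert hj]
    exact ⟨hj'.add ih.1, by rw [multiDeriv_add μ hj' ih.1, ih.2, multiDeriv_smul μ _ (hf j)]⟩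

theorem multiDeriv_sub (μ : Fin k → ℕ) {f g : (Fin k → ℝ) → 𝕜} (hf : ContDiff ℝ ∞ f)
    (hg : ContDiff ℝ ∞ g) : multiDeriv μ (f - g) = multiDeriv μ f - multiDeriv μ g := by
  have hg' : ContDiff ℝ ∞ ((-1 : 𝕜) • g) := hg.const_smul (-1 : 𝕜)
  have h : f - g = f + (-1 : 𝕜) • g := by simp [sub_eq_add_neg]
  rw [h, multiDeriv_add μ hf hg', multiDeriv_smul μ _ hg]
  simp [sub_eq_add_neg]

theorem fderiv_eq_sum_partialDeriv {f : (Fin k → ℝ) → 𝕜} (hf : ContDiff ℝ ∞ f) (x : Fin k → ℝ) :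
    fderiv ℝ f x =
      ∑ i, (ContinuousLinearMap.proj (R := ℝ) (φ := fun _ : Fin k => ℝ) i).smulRight
        (partialDeriv i f x) := by
  ext v
  conv_lhs => rw [← Finset.univ_sum_single v, map_sum]
  rw [_root_.sum_apply]
  refine Finset.sum_congr rfl fun i _ => ?_
  rw [partialDeriv_eq_fderiv i hf]
  have : (Pi.single i (v i) : Fin k → ℝ) = v i • Pi.single i 1 := by
    rw [← Pi.single_smul]; simp
  rw [this, map_smul]
  rfl

theorem sum_add_single (μ : Fin k → ℕ) (i : Fin k) :
    ∑ j, (μ + Pi.single i 1 : Fin k → ℕ) j = ∑ j, μ j + 1 := by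
  simp [Finset.sum_add_distrib]

theorem multiIndices_mono (k : ℕ) {m n : ℕ} (h : m ≤ n) : multiIndices k m ⊆ multiIndices k n :=
  fun _ hμ => mem_multiIndices.2 ((mem_multiIndices.1 hμ).trans h)

/-- The shift of indices is injective and raises the order by one. This absorbs the extra derivative
produced by each one-dimensional Sobolev step. -/
theorem sum_multiIndices_add_single_le (i : Fin k) (m : ℕ) (F : (Fin k → ℕ) → ENNReal) :
    ∑ μ ∈ multiIndices k m, F (μ + Pi.single i 1) ≤ ∑ μ ∈ multiIndices k (m + 1), F μ := by
  have hinj : Function.Injective fun μ : Fin k → ℕ => μ + Pi.single i 1 := add_left_injective _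
  refine (Finset.sum_map (multiIndices k m) ⟨_, hinj⟩ F).symm.trans_le ?_
  refine Finset.sum_le_sum_of_subset fun ν hν => ?_
  obtain ⟨μ, hμ, rfl⟩ := Finset.mem_map.1 hν
  have := mem_multiIndices.1 hμ
  simpa only [Function.Embedding.coeFn_mk, mem_multiIndices, sum_add_single,
    add_le_add_iff_right] using this

end MultiIndexCalculus

/-! ### Nuclear maps, Hilbert–Schmidt maps and two-summing seminorms -/

section Nuclearity

variable {𝕜 : Type*} [RCLike 𝕜]

/-- A summable representation over an arbitrary index type can be rewritten over `ℕ`. -/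
theorem IsNuclearMap.of_index {X Y : Type*} [NormedAddCommGroup X] [NormedSpace 𝕜 X]
    [NormedAddCommGroup Y] [NormedSpace 𝕜 Y] {T : X →L[𝕜] Y} {ι : Type*} (φ : ι → X →L[𝕜] 𝕜)
    (y : ι → Y) (hs : Summable fun i => ‖φ i‖ * ‖y i‖)
    (hT : ∀ x, HasSum (fun i => φ i x • y i) (T x)) : IsNuclearMap T := by
  classical
  -- A summable family has countable support, so the nonzero terms embed in `ℕ` and the remaining
  -- places are filled with zeros.
  have hc := hs.countable_support
  set S := Function.support fun i => ‖φ i‖ * ‖y i‖ with hS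
  have : Countable S := hc
  obtain ⟨e, he⟩ := Countable.exists_injective_nat S
  have hzero : ∀ i ∉ S, ∀ x, φ i x • y i = 0 := by
    intro i hi x
    rw [hS, Function.notMem_support, mul_eq_zero, norm_eq_zero, norm_eq_zero] at hi
    rcases hi with h | h <;> simp [h]
  refine ⟨Function.extend e (fun i => φ i) 0, Function.extend e (fun i => y i) 0, ?_, fun x => ?_⟩
  · have h1 : Summable fun i : S => ‖φ i‖ * ‖y i‖ := hs.subtype S
    have h2 : (fun n => ‖Function.extend e (fun i : S => φ i) 0 n‖ *
        ‖Function.extend e (fun i : S => y i) 0 n‖) =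
        Function.extend e (fun i : S => ‖φ i‖ * ‖y i‖) 0 := by
      funext n
      by_cases hn : ∃ i, e i = n
      · obtain ⟨i, rfl⟩ := hn
        simp [he.extend_apply]
      · simp [Function.extend_apply' _ _ _ hn]
    rw [h2]
    exact (summable_extend_zero he).2 h1
  · have h1 : HasSum (fun i : S => φ i x • y i) (T x) := by
      have := hT x
      rw [← hasSum_subtype_iff_of_support_subset (s := S)] at this
      · exact this
      · intro i hi
        by_contra h
        exact hi (hzero i h x)
    have h2 : (fun n => (Function.extend e (fun i : S => φ i) 0 n) x •
        Function.extend e (fun i : S => y i) 0 n) =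
        Function.extend e (fun i : S => φ i x • y i) 0 := by
      funext n
      by_cases hn : ∃ i, e i = n
      · obtain ⟨i, rfl⟩ := hn
        simp [he.extend_apply]
      · simp [Function.extend_apply' _ _ _ hn]
    rw [h2]
    exact (hasSum_extend_zero he).2 h1

/-- `T` is Hilbert–Schmidt with squared norm at most `C`. -/
def HilbertSchmidtBound {H Y : Type*} [NormedAddCommGroup H] [InnerProductSpace 𝕜 H]
    [NormedAddCommGroup Y] [NormedSpace 𝕜 Y] (T : H →L[𝕜] Y) (C : ℝ) : Prop :=
  ∀ (n : ℕ) (v : Fin n → H), Orthonormal 𝕜 v → ∑ j, ‖T (v j)‖ ^ 2 ≤ C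

theorem HilbertSchmidtBound.sum_le {H Y : Type*} [NormedAddCommGroup H] [InnerProductSpace 𝕜 H]
    [NormedAddCommGroup Y] [NormedSpace 𝕜 Y] {T : H →L[𝕜] Y} {C : ℝ}
    (hT : HilbertSchmidtBound T C) {ι : Type*} {v : ι → H} (hv : Orthonormal 𝕜 v)
    (s : Finset ι) : ∑ i ∈ s, ‖T (v i)‖ ^ 2 ≤ C := by
  have h := hT s.card (fun j => v (s.equivFin.symm j))
    (hv.comp _ (Subtype.val_injective.comp s.equivFin.symm.injective))
  rw [← Finset.sum_coe_sort s]
  refine le_trans (le_of_eq ?_) h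
  exact (Equiv.sum_comp s.equivFin.symm fun i : s => ‖T (v i)‖ ^ 2).symm

theorem HilbertSchmidtBound.summable {H Y : Type*} [NormedAddCommGroup H]
    [InnerProductSpace 𝕜 H] [NormedAddCommGroup Y] [NormedSpace 𝕜 Y] {T : H →L[𝕜] Y} {C : ℝ}
    (hT : HilbertSchmidtBound T C) {ι : Type*} {v : ι → H} (hv : Orthonormal 𝕜 v) :
    Summable fun i => ‖T (v i)‖ ^ 2 :=
  summable_of_sum_le (fun _ => sq_nonneg _) fun s => hT.sum_le hv s

/-- Parseval's identity in `[0, ∞]`, where double sums can be interchanged without a summability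
hypothesis. -/
theorem HilbertBasis.tsum_enorm_inner_sq {H ι : Type*} [NormedAddCommGroup H]
    [InnerProductSpace 𝕜 H] (b : HilbertBasis ι 𝕜 H) (x : H) :
    ∑' i, ‖inner 𝕜 (b i) x‖ₑ ^ 2 = ‖x‖ₑ ^ 2 := by
  have h : HasSum (fun i => ‖inner 𝕜 (b i) x‖ ^ 2) (‖x‖ ^ 2) := by
    have h1 := lp.hasSum_norm (p := 2) (by simp) (b.repr x)
    simpa [b.repr_apply_apply] using h1
  have h2 := ENNReal.ofReal_tsum_of_nonneg (fun i => sq_nonneg ‖inner 𝕜 (b i) x‖) h.summable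
  rw [h.tsum_eq, ENNReal.ofReal_pow (norm_nonneg _), ofReal_norm] at h2
  rw [h2]
  congr 1
  funext i
  rw [ENNReal.ofReal_pow (norm_nonneg _), ofReal_norm]

/-- The double sum of `|⟨b_i, A d_j⟩| ^ 2` over two Hilbert bases gives the Hilbert–Schmidt norm of
`A` or of its adjoint, depending on the order of summation. -/
theorem HilbertSchmidtBound.summable_adjoint {H G ι : Type*} [NormedAddCommGroup H]
    [InnerProductSpace 𝕜 H] [CompleteSpace H] [NormedAddCommGroup G] [InnerProductSpace 𝕜 G]
    [CompleteSpace G] {A : H →L[𝕜] G} {C : ℝ} (hA : HilbertSchmidtBound A C)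
    (b : HilbertBasis ι 𝕜 G) : Summable fun i => ‖A.adjoint (b i)‖ ^ 2 := by
  obtain ⟨w, d, -⟩ := exists_hilbertBasis 𝕜 H
  have h1 : ∑' i, ‖A.adjoint (b i)‖ₑ ^ 2 = ∑' j, ‖A (d j)‖ₑ ^ 2 := by
    calc ∑' i, ‖A.adjoint (b i)‖ₑ ^ 2
        = ∑' i, ∑' j, ‖inner 𝕜 (d j) (A.adjoint (b i))‖ₑ ^ 2 := by
          simp only [d.tsum_enorm_inner_sq]
      _ = ∑' j, ∑' i, ‖inner 𝕜 (d j) (A.adjoint (b i))‖ₑ ^ 2 := ENNReal.tsum_comm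
      _ = ∑' j, ∑' i, ‖inner 𝕜 (b i) (A (d j))‖ₑ ^ 2 := by
          refine tsum_congr fun j => tsum_congr fun i => ?_
          rw [A.adjoint_inner_right, ← ofReal_norm, ← ofReal_norm,
            norm_inner_symm]
      _ = ∑' j, ‖A (d j)‖ₑ ^ 2 := by simp only [b.tsum_enorm_inner_sq]
  have h2 : ∑' j, ‖A (d j)‖ₑ ^ 2 ≠ ⊤ := by
    have := (hA.summable d.orthonormal).tsum_ofReal_ne_top
    simpa only [ENNReal.ofReal_pow (norm_nonneg _), ofReal_norm] using this
  rw [← h1] at h2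
  have h3 := ENNReal.summable_toReal h2
  simpa using h3

/-- The composition of two Hilbert–Schmidt maps is nuclear. -/
theorem HilbertSchmidtBound.isNuclearMap_comp {H G Y : Type*} [NormedAddCommGroup H]
    [InnerProductSpace 𝕜 H] [CompleteSpace H] [NormedAddCommGroup G] [InnerProductSpace 𝕜 G]
    [CompleteSpace G] [NormedAddCommGroup Y] [NormedSpace 𝕜 Y] {A : H →L[𝕜] G} {B : G →L[𝕜] Y}
    {C D : ℝ} (hA : HilbertSchmidtBound A C) (hB : HilbertSchmidtBound B D) :
    IsNuclearMap (B.comp A) := by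
  obtain ⟨w, b, -⟩ := exists_hilbertBasis 𝕜 G
  -- Expanding `A x` in the basis `b` gives `B (A x) = ∑ ⟨A* b_i, x⟩ B b_i`. Both factors have
  -- square-summable norms, so the products of the norms are summable.
  refine IsNuclearMap.of_index (fun i => innerSL 𝕜 (A.adjoint (b i))) (fun i => B (b i)) ?_ ?_
  · simp only [innerSL_apply_norm]
    refine Summable.of_nonneg_of_le (fun i => by positivity) (fun i => ?_)
      ((hA.summable_adjoint b).add (hB.summable b.orthonormal))
    nlinarith [sq_nonneg (‖A.adjoint (b i)‖ - ‖B (b i)‖), sq_nonneg ‖A.adjoint (b i)‖,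
      sq_nonneg ‖B (b i)‖]
  · intro x
    have h := (b.hasSum_repr (A x)).mapL B
    simpa [b.repr_apply_apply, A.adjoint_inner_left] using h

variable {F : Type*} [AddCommGroup F] [Module 𝕜 F]

theorem norm_coe_localBanachSpace (p : Seminorm 𝕜 F) (f : F) :
    ‖((show SeminormedBy p from f : SeminormedBy p) : LocalBanachSpace p)‖ = p f :=
  UniformSpace.Completion.norm_coe (E := SeminormedBy p) f

theorem localBanachMap_coe {p q : Seminorm 𝕜 F} (h : p ≤ q) (f : F) :
    localBanachMap h ((show SeminormedBy q from f : SeminormedBy q) : LocalBanachSpace q) =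
      ((show SeminormedBy p from f : SeminormedBy p) : LocalBanachSpace p) :=
  UniformSpace.Completion.map_coe (seminormedByMap h).uniformContinuous _

theorem localBanachMap_comp {p q r : Seminorm 𝕜 F} (h : p ≤ q) (h' : q ≤ r) :
    (localBanachMap h).comp (localBanachMap h') = localBanachMap (h.trans h') := by
  ext x
  induction x using UniformSpace.Completion.induction_on with
  | hp => exact isClosed_eq (by fun_prop) (by fun_prop)
  | ih a =>
    exact ((congrArg (localBanachMap h) (localBanachMap_coe h' a)).trans
      (localBanachMap_coe h a)).trans (localBanachMap_coe (h.trans h') a).symm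

/-- The parallelogram law for a seminorm. -/
def IsHilbertSeminorm (q : Seminorm 𝕜 F) : Prop :=
  ∀ f g : F, q (f + g) ^ 2 + q (f - g) ^ 2 = 2 * (q f ^ 2 + q g ^ 2)

/-- The local Banach space of a seminorm with the parallelogram law is a Hilbert space. -/
@[reducible] noncomputable def IsHilbertSeminorm.innerProductSpace {q : Seminorm 𝕜 F}
    (hq : IsHilbertSeminorm q) : InnerProductSpace 𝕜 (LocalBanachSpace q) :=
  InnerProductSpace.ofNorm 𝕜 fun x y => by
    induction x, y using UniformSpace.Completion.induction_on₂ with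
    | hp => exact isClosed_eq (by fun_prop) (by fun_prop)
    | ih a b =>
      rw [← UniformSpace.Completion.coe_add, ← UniformSpace.Completion.coe_sub]
      simp only [UniformSpace.Completion.norm_coe, ← sq]
      exact hq a b

/-- `p` is `2`-summing with respect to `q`, in terms of weakly `2`-bounded finite families. -/
def IsTwoSumming (p q : Seminorm 𝕜 F) (C : ℝ) : Prop :=
  ∀ (n : ℕ) (f : Fin n → F) (K : ℝ), 0 ≤ K →
    (∀ a : Fin n → 𝕜, q (∑ j, a j • f j) ^ 2 ≤ K * ∑ j, ‖a j‖ ^ 2) →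
    ∑ j, p (f j) ^ 2 ≤ C * K

/-- The synthesis map `a ↦ ∑ a_j v_j` from Euclidean space. -/
noncomputable def synthesis {X : Type*} [NormedAddCommGroup X] [NormedSpace 𝕜 X] {n : ℕ}
    (v : Fin n → X) : EuclideanSpace 𝕜 (Fin n) →L[𝕜] X :=
  ∑ j, (EuclideanSpace.proj (𝕜 := 𝕜) j).smulRight (v j)

theorem synthesis_apply {X : Type*} [NormedAddCommGroup X] [NormedSpace 𝕜 X] {n : ℕ}
    (v : Fin n → X) (a : EuclideanSpace 𝕜 (Fin n)) : synthesis v a = ∑ j, a j • v j := by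
  simp [synthesis, _root_.sum_apply]

theorem continuous_synthesis {X : Type*} [NormedAddCommGroup X] [NormedSpace 𝕜 X] (n : ℕ) :
    Continuous (synthesis (𝕜 := 𝕜) : (Fin n → X) → _) := by
  unfold synthesis
  refine continuous_finsetSum _ fun j _ => ?_
  exact (ContinuousLinearMap.smulRightL 𝕜 (EuclideanSpace 𝕜 (Fin n)) X
    (EuclideanSpace.proj j)).continuous.comp (continuous_apply j)

/-- For a family from `F`, the squared norm of the synthesis map is an admissible `K`. Both sides
are continuous in the family, so density of `F` in its completion extends the bound to families in
the local Banach space. -/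
theorem IsTwoSumming.sum_norm_le {p q : Seminorm 𝕜 F} (h : p ≤ q) {C : ℝ}
    (hC : IsTwoSumming p q C) {n : ℕ} (v : Fin n → LocalBanachSpace q) :
    ∑ j, ‖localBanachMap h (v j)‖ ^ 2 ≤ C * ‖synthesis (𝕜 := 𝕜) v‖ ^ 2 := by
  have hd : DenseRange fun (f : Fin n → SeminormedBy q) (j : Fin n) =>
      (f j : LocalBanachSpace q) :=
    DenseRange.piMap fun _ => UniformSpace.Completion.denseRange_coe
  refine hd.induction_on (p := fun v => ∑ j, ‖localBanachMap h (v j)‖ ^ 2 ≤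
    C * ‖synthesis (𝕜 := 𝕜) v‖ ^ 2) v ?_ ?_
  · exact isClosed_le (by fun_prop) (((continuous_synthesis n).norm.pow 2).const_mul C)
  · intro f
    have h1 : ∀ j, ‖localBanachMap h (f j : LocalBanachSpace q)‖ = p (f j) := by
      intro j
      exact (congrArg norm (localBanachMap_coe h (f j))).trans (norm_coe_localBanachSpace p _)
    simp only [h1]
    refine hC n f _ (sq_nonneg _) fun a => ?_
    have h2 := (synthesis (𝕜 := 𝕜) fun j => (f j : LocalBanachSpace q)).le_opNorm
      (WithLp.toLp 2 a)
    have h3 : synthesis (𝕜 := 𝕜) (fun j => (f j : LocalBanachSpace q)) (WithLp.toLp 2 a) =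
        ((∑ j, a j • f j : SeminormedBy q) : LocalBanachSpace q) := by
      rw [synthesis_apply]
      change _ = UniformSpace.Completion.toComplₗᵢ (𝕜 := 𝕜) (∑ j, a j • f j)
      rw [map_sum]
      simp
    have h4 : ‖((∑ j, a j • f j : SeminormedBy q) : LocalBanachSpace q)‖ =
        q (∑ j, a j • (show F from f j)) := norm_coe_localBanachSpace q _
    rw [h3, h4] at h2
    have h5 : ‖(WithLp.toLp 2 a : EuclideanSpace 𝕜 (Fin n))‖ ^ 2 = ∑ j, ‖a j‖ ^ 2 :=
      EuclideanSpace.norm_sq_eq _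
    rw [← h5, ← mul_pow]
    exact pow_le_pow_left₀ (apply_nonneg q _) h2 2

/-- Synthesis along an orthonormal family is isometric by Pythagoras; this is how a two-summing
bound becomes a Hilbert–Schmidt bound. -/
theorem norm_synthesis_le_one {H : Type*} [NormedAddCommGroup H] [InnerProductSpace 𝕜 H] {n : ℕ}
    {v : Fin n → H} (hv : Orthonormal 𝕜 v) : ‖synthesis (𝕜 := 𝕜) v‖ ≤ 1 := by
  refine ContinuousLinearMap.opNorm_le_bound _ zero_le_one fun a => ?_
  rw [one_mul, synthesis_apply, ← sq_le_sq₀ (norm_nonneg _) (norm_nonneg _),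
    EuclideanSpace.norm_sq_eq]
  have h := hv.inner_sum a a Finset.univ
  have h2 := inner_self_eq_norm_sq_to_K (𝕜 := 𝕜) (∑ j, a j • v j)
  rw [h2] at h
  have h3 : ((‖∑ j, a j • v j‖ ^ 2 : ℝ) : 𝕜) = ((∑ j, ‖a j‖ ^ 2 : ℝ) : 𝕜) := by
    push_cast
    rw [h]
    exact Finset.sum_congr rfl fun j _ => RCLike.conj_mul _
  exact le_of_eq (RCLike.ofReal_injective h3)

/-- Only `q` and `r` must come from inner products: the second Hilbert–Schmidt factor may take
values in any Banach space, so `p` is arbitrary. -/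
theorem IsTwoSumming.isNuclearMap {p q r : Seminorm 𝕜 F} (h : p ≤ q) (h' : q ≤ r) {C D : ℝ}
    (hC0 : 0 ≤ C) (hD0 : 0 ≤ D) (hC : IsTwoSumming p q C) (hD : IsTwoSumming q r D)
    (hq : IsHilbertSeminorm q) (hr : IsHilbertSeminorm r) :
    IsNuclearMap (localBanachMap (h.trans h')) := by
  let := hq.innerProductSpace
  let := hr.innerProductSpace
  rw [← localBanachMap_comp h h']
  have aux : ∀ {a E : ℝ}, 0 ≤ E → 0 ≤ a → a ≤ 1 → E * a ^ 2 ≤ E := fun hE ha ha' =>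
    mul_le_of_le_one_right hE (pow_le_one₀ ha ha')
  exact HilbertSchmidtBound.isNuclearMap_comp (C := D) (D := C)
    (fun n v hv => (hD.sum_norm_le h' v).trans
      (aux hD0 (norm_nonneg _) (norm_synthesis_le_one hv)))
    (fun n v hv => (hC.sum_norm_le h v).trans
      (aux hC0 (norm_nonneg _) (norm_synthesis_le_one hv)))

end Nuclearity

/-! ### Comparison of the supremum and integral seminorms -/

section Comparison

variable {𝕜 : Type*} [RCLike 𝕜] {k : ℕ} {Γ : Type*} {M : DefiningFamily k Γ}

/-- In condition (I) the summable function can be taken bounded by `1`. -/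
theorem DefiningFamily.CondI.bounded (hI : M.CondI) (γ : Γ) :
    ∃ (γ' : Γ) (L : (Fin k → ℝ) → ℝ) (C : ℝ), 0 < C ∧ (∀ x, 0 ≤ L x) ∧ (∀ x, L x ≤ 1) ∧
      Integrable L volume ∧ ∀ x, M γ x ≤ C * L x * M γ' x := by
  obtain ⟨γ₁, L, hL0, hLi, -, hL⟩ := hI γ
  obtain ⟨γ₂, c, hc, h⟩ := M.directed γ γ₁
  have hn1 : ∀ x, M γ x ≤ c⁻¹ * M γ₂ x := fun x => by
    rw [le_inv_mul_iff₀ hc]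
    nlinarith [h x, M.nonneg γ₁ x]
  have hn2 : ∀ x, M γ₁ x ≤ c⁻¹ * M γ₂ x := fun x => by
    rw [le_inv_mul_iff₀ hc]
    nlinarith [h x, M.nonneg γ x]
  -- The weight `M γ₂` dominates both `M γ₁` and `M γ`. Condition (I) is used where `L ≤ 1`, and the
  -- direct bound of `M γ` by `M γ₂` where `L ≥ 1`.
  refine ⟨γ₂, fun x => min (L x) 1, c⁻¹, by positivity, fun x => le_min (hL0 x) zero_le_one,
    fun x => min_le_right _ _, ?_, fun x => ?_⟩
  · refine hLi.mono (hLi.1.inf aestronglyMeasurable_const) (ae_of_all _ fun x => ?_)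
    rw [Real.norm_of_nonneg (le_min (hL0 x) zero_le_one), Real.norm_of_nonneg (hL0 x)]
    exact min_le_left _ _
  · rcases le_total (L x) 1 with h1 | h1
    · simp only [min_eq_left h1]
      calc M γ x ≤ L x * M γ₁ x := hL x
        _ ≤ L x * (c⁻¹ * M γ₂ x) := mul_le_mul_of_nonneg_left (hn2 x) (hL0 x)
        _ = _ := by ring
    · simpa only [min_eq_right h1, mul_one] using hn1 x

theorem le_supNorm {γ : Γ} {m : ℕ} {f : (Fin k → ℝ) → 𝕜} (hf : SupNormFinite M γ m f)
    (x : Fin k → ℝ) {μ : Fin k → ℕ} (hμ : μ ∈ multiIndices k m) :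
    M γ x * ‖multiDeriv μ f x‖ ≤ supNorm M γ m f :=
  le_ciSup hf (⟨x, ⟨μ, hμ⟩⟩ : (Fin k → ℝ) × multiIndices k m)

theorem supNorm_nonneg (γ : Γ) (m : ℕ) (f : (Fin k → ℝ) → 𝕜) : 0 ≤ supNorm M γ m f :=
  Real.iSup_nonneg fun _ => mul_nonneg (M.nonneg _ _) (norm_nonneg _)

theorem supNorm_le {γ : Γ} {m : ℕ} {f : (Fin k → ℝ) → 𝕜} {A : ℝ}
    (h : ∀ x, ∀ μ ∈ multiIndices k m, M γ x * ‖multiDeriv μ f x‖ ≤ A) :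
    SupNormFinite M γ m f ∧ supNorm M γ m f ≤ A :=
  ⟨⟨A, by rintro _ ⟨q, rfl⟩; exact h q.1 q.2.1 q.2.2⟩, ciSup_le fun q => h q.1 q.2.1 q.2.2⟩

theorem kpIntegrand_eq_sum (p : ℝ) (γ : Γ) (m : ℕ) (f : (Fin k → ℝ) → 𝕜) (x : Fin k → ℝ) :
    kpIntegrand M p γ m f x = ∑ μ ∈ multiIndices k m, (M γ x * ‖multiDeriv μ f x‖) ^ p := by
  rw [kpIntegrand, Finset.mul_sum]
  exact Finset.sum_congr rfl fun μ _ => (Real.mul_rpow (M.nonneg _ _) (norm_nonneg _)).symm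

/-- Each weighted derivative is at most `c S L` with `S` the supremum norm. Since `0 ≤ L ≤ 1` and `p
≥ 1`, its `p`-th power is at most `(c S) ^ p L`, which is integrable. -/
theorem kpNorm_le_supNorm (hI : M.CondI) {p : ℝ} (hp : 1 ≤ p) (γ : Γ) (m : ℕ) :
    ∃ (γ' : Γ) (C : ℝ), 0 ≤ C ∧ ∀ f : (Fin k → ℝ) → 𝕜, ContDiff ℝ ∞ f →
      SupNormFinite M γ' m f →
      Integrable (kpIntegrand M p γ m f) ∧ kpNorm M p γ m f ≤ C * supNorm M γ' m f := by
  have hp0 : 0 < p := by linarith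
  obtain ⟨γ', L, c, hc, hL0, hL1, hLi, hL⟩ := hI.bounded γ
  set N : ℝ := ((multiIndices k m).card : ℝ)
  have hIL : 0 ≤ ∫ x, L x := integral_nonneg hL0
  refine ⟨γ', (N * ∫ x, L x) ^ (1 / p) * c, by positivity, fun f hf hfin => ?_⟩
  set S := supNorm M γ' m f
  have hS : 0 ≤ S := supNorm_nonneg _ _ _
  have hb : ∀ x, kpIntegrand M p γ m f x ≤ N * (c * S) ^ p * L x := by
    intro x
    rw [kpIntegrand_eq_sum]
    have hterm : ∀ μ ∈ multiIndices k m,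
        (M γ x * ‖multiDeriv μ f x‖) ^ p ≤ (c * S) ^ p * L x := by
      intro μ hμ
      have h1 : M γ x * ‖multiDeriv μ f x‖ ≤ c * S * L x := by
        calc M γ x * ‖multiDeriv μ f x‖ ≤ (c * L x * M γ' x) * ‖multiDeriv μ f x‖ :=
              mul_le_mul_of_nonneg_right (hL x) (norm_nonneg _)
          _ = c * L x * (M γ' x * ‖multiDeriv μ f x‖) := by ring
          _ ≤ c * L x * S := mul_le_mul_of_nonneg_left (le_supNorm hfin x hμ)
              (mul_nonneg hc.le (hL0 x))
          _ = _ := by ring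
      calc (M γ x * ‖multiDeriv μ f x‖) ^ p ≤ (c * S * L x) ^ p :=
            Real.rpow_le_rpow (mul_nonneg (M.nonneg _ _) (norm_nonneg _)) h1 hp0.le
        _ = (c * S) ^ p * L x ^ p := Real.mul_rpow (by positivity) (hL0 x)
        _ ≤ (c * S) ^ p * L x := mul_le_mul_of_nonneg_left
            (Real.rpow_le_self_of_le_one (hL0 x) (hL1 x) hp) (by positivity)
    calc _ ≤ ∑ _μ ∈ multiIndices k m, (c * S) ^ p * L x := Finset.sum_le_sum hterm
      _ = _ := by rw [Finset.sum_const, nsmul_eq_mul]; ring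
  have hint : Integrable (kpIntegrand M p γ m f) := by
    refine (hLi.const_mul (N * (c * S) ^ p)).mono'
      (aemeasurable_kpIntegrand M p γ m hf).aestronglyMeasurable (ae_of_all _ fun x => ?_)
    rw [Real.norm_of_nonneg (kpIntegrand_nonneg M p γ m f x)]
    exact hb x
  refine ⟨hint, ?_⟩
  have hle : ∫ x, kpIntegrand M p γ m f x ≤ (N * ∫ x, L x) * (c * S) ^ p := by
    calc _ ≤ ∫ x, N * (c * S) ^ p * L x := integral_mono hint (hLi.const_mul _) hb
      _ = _ := by rw [integral_const_mul]; ring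
  calc kpNorm M p γ m f ≤ ((N * ∫ x, L x) * (c * S) ^ p) ^ (1 / p) :=
        Real.rpow_le_rpow (integral_nonneg (kpIntegrand_nonneg M p γ m f)) hle (by positivity)
    _ = _ := by
      rw [Real.mul_rpow (by positivity) (by positivity), ← Real.rpow_mul (by positivity),
        mul_one_div_cancel hp0.ne', Real.rpow_one]
      ring

/-- Averaging `h a = h t - ∫_a^t h'` over `t` in an interval of length `δ` costs `δ⁻¹` on `h` and
`1` on `h'`; the sum of the two constants serves for both. -/
theorem enorm_le_lintegral_add_deriv {h : ℝ → 𝕜} (hh : ContDiff ℝ 1 h) (a : ℝ) {δ : ℝ}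
    (hδ : 0 < δ) : ‖h a‖ₑ ≤ (ENNReal.ofReal δ⁻¹ + 1) *
      ∫⁻ t in Set.Icc a (a + δ), (‖h t‖ₑ + ‖deriv h t‖ₑ) := by
  set I := Set.Icc a (a + δ)
  have hvol : volume I = ENNReal.ofReal δ := by simp [I]
  have hcd : Continuous (deriv h) := hh.continuous_deriv le_rfl
  have h1 : ∀ t ∈ I, ‖h a‖ₑ ≤ ‖h t‖ₑ + ∫⁻ s in I, ‖deriv h s‖ₑ := by
    intro t ht
    calc ‖h a‖ₑ = ‖h t - (h t - h a)‖ₑ := by simp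
      _ ≤ ‖h t‖ₑ + ‖h t - h a‖ₑ := enorm_sub_le
      _ ≤ ‖h t‖ₑ + ∫⁻ s in Set.Icc a t, ‖deriv h s‖ₑ := by
        gcongr
        exact enorm_sub_le_lintegral_deriv_of_contDiffOn_Icc hh.contDiffOn ht.1
      _ ≤ _ := by
        gcongr
        exact Set.Icc_subset_Icc_right ht.2
  have h2 : ‖h a‖ₑ * ENNReal.ofReal δ ≤
      (∫⁻ t in I, ‖h t‖ₑ) + (∫⁻ s in I, ‖deriv h s‖ₑ) * ENNReal.ofReal δ := by
    calc ‖h a‖ₑ * ENNReal.ofReal δ = ∫⁻ _t in I, ‖h a‖ₑ := by rw [setLIntegral_const, hvol]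
      _ ≤ ∫⁻ t in I, (‖h t‖ₑ + ∫⁻ s in I, ‖deriv h s‖ₑ) :=
        setLIntegral_mono' measurableSet_Icc h1
      _ = _ := by
        rw [lintegral_add_right _ measurable_const, setLIntegral_const, hvol]
  have h3 : ENNReal.ofReal δ * ENNReal.ofReal δ⁻¹ = 1 := by
    rw [← ENNReal.ofReal_mul hδ.le, mul_inv_cancel₀ hδ.ne', ENNReal.ofReal_one]
  calc ‖h a‖ₑ = ‖h a‖ₑ * ENNReal.ofReal δ * ENNReal.ofReal δ⁻¹ := by rw [mul_assoc, h3, mul_one]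
    _ ≤ ((∫⁻ t in I, ‖h t‖ₑ) + (∫⁻ s in I, ‖deriv h s‖ₑ) * ENNReal.ofReal δ) *
        ENNReal.ofReal δ⁻¹ := by gcongr
    _ = ENNReal.ofReal δ⁻¹ * (∫⁻ t in I, ‖h t‖ₑ) + 1 * (∫⁻ s in I, ‖deriv h s‖ₑ) := by
        rw [add_mul, mul_assoc _ (ENNReal.ofReal δ), h3]; ring
    _ ≤ (ENNReal.ofReal δ⁻¹ + 1) * (∫⁻ t in I, ‖h t‖ₑ) +
        (ENNReal.ofReal δ⁻¹ + 1) * (∫⁻ s in I, ‖deriv h s‖ₑ) := by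
        gcongr
        · exact le_self_add
        · exact le_add_self
    _ = _ := by
        rw [lintegral_add_right _ hcd.measurable.enorm, mul_add]

/-- `∑_{|μ| ≤ m} |∂^μ f|`, with values in `[0, ∞]`. -/
noncomputable def derivSum (m : ℕ) (f : (Fin k → ℝ) → 𝕜) (x : Fin k → ℝ) : ENNReal :=
  ∑ μ ∈ multiIndices k m, ‖multiDeriv μ f x‖ₑ

theorem measurable_derivSum (m : ℕ) {f : (Fin k → ℝ) → 𝕜} (hf : ContDiff ℝ ∞ f) :
    Measurable (derivSum m f) :=
  Finset.measurable_sum _ fun μ _ => (contDiff_multiDeriv μ hf).continuous.measurable.enorm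

/-- The one-dimensional estimate is applied along coordinate `i` to each derivative. The derivatives
and their shifts by one order are each bounded by the same sum of order `m + 1`, whence the factor
`2`. -/
theorem derivSum_le_lintegral_update {δ : ℝ} (hδ : 0 < δ) (m : ℕ) {f : (Fin k → ℝ) → 𝕜}
    (hf : ContDiff ℝ ∞ f) (i : Fin k) (x : Fin k → ℝ) :
    derivSum m f x ≤ (2 * (ENNReal.ofReal δ⁻¹ + 1)) *
      ∫⁻ t in Set.Icc (x i) (x i + δ), derivSum (m + 1) f (Function.update x i t) := by
  have hder : ∀ μ t, HasDerivAt (fun t => multiDeriv μ f (Function.update x i t))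
      (multiDeriv (μ + Pi.single i 1) f (Function.update x i t)) t := by
    intro μ t
    rw [← partialDeriv_multiDeriv i μ hf, partialDeriv_eq_fderiv i (contDiff_multiDeriv μ hf)]
    exact (((contDiff_multiDeriv μ hf).differentiable (by simp) _).hasFDerivAt).comp_hasDerivAt t
      (hasDerivAt_update x i t)
  have hsm : ∀ μ, ContDiff ℝ 1 (fun t => multiDeriv μ f (Function.update x i t)) := by
    intro μ
    exact ((contDiff_multiDeriv μ hf).of_le (by simp)).comp (contDiff_update 1 x i)
  have hmeas : ∀ μ, Measurable fun t => ‖multiDeriv μ f (Function.update x i t)‖ₑ :=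
    fun μ => (hsm μ).continuous.measurable.enorm
  set c := ENNReal.ofReal δ⁻¹ + 1
  calc derivSum m f x
      ≤ ∑ μ ∈ multiIndices k m, c * ∫⁻ t in Set.Icc (x i) (x i + δ),
        (‖multiDeriv μ f (Function.update x i t)‖ₑ +
          ‖multiDeriv (μ + Pi.single i 1) f (Function.update x i t)‖ₑ) := by
        refine Finset.sum_le_sum fun μ _ => ?_
        have h := enorm_le_lintegral_add_deriv (hsm μ) (x i) hδ
        simpa only [Function.update_eq_self, (hder μ _).deriv] using h
    _ = c * ∫⁻ t in Set.Icc (x i) (x i + δ), ∑ μ ∈ multiIndices k m,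
        (‖multiDeriv μ f (Function.update x i t)‖ₑ +
          ‖multiDeriv (μ + Pi.single i 1) f (Function.update x i t)‖ₑ) := by
        rw [lintegral_finsetSum _ fun μ _ => by exact (hmeas μ).add (hmeas _), Finset.mul_sum]
    _ ≤ c * ∫⁻ t in Set.Icc (x i) (x i + δ),
        2 * derivSum (m + 1) f (Function.update x i t) := by
        gcongr with t
        rw [Finset.sum_add_distrib, two_mul]
        refine add_le_add (Finset.sum_le_sum_of_subset (multiIndices_mono k m.le_succ)) ?_
        exact sum_multiIndices_add_single_le i m
          fun μ => ‖multiDeriv μ f (Function.update x i t)‖ₑ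
    _ = _ := by
        rw [lintegral_const_mul _ (by exact (measurable_derivSum _ hf).comp (measurable_update x))]
        ring

/-- Coordinates are integrated out one at a time, each at the price of one derivative and one
constant factor. -/
theorem derivSum_le_lmarginal {δ : ℝ} (hδ : 0 < δ) (m : ℕ) {f : (Fin k → ℝ) → 𝕜}
    (hf : ContDiff ℝ ∞ f) (x : Fin k → ℝ) (s : Finset (Fin k)) :
    derivSum m f x ≤ (2 * (ENNReal.ofReal δ⁻¹ + 1)) ^ s.card *
      (∫⋯∫⁻_s, derivSum (m + s.card) f
        ∂(fun i => volume.restrict (Set.Icc (x i) (x i + δ)))) x := by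
  induction s using Finset.induction_on with
  | empty => simp
  | insert i s hi ih =>
    set c := 2 * (ENNReal.ofReal δ⁻¹ + 1)
    have hc : c ≠ ⊤ := by simp [c, ENNReal.mul_eq_top]
    rw [lmarginal_insert' _ (measurable_derivSum _ hf) hi, Finset.card_insert_of_notMem hi]
    refine ih.trans ?_
    rw [pow_succ, mul_assoc]
    gcongr
    unfold lmarginal
    rw [← lintegral_const_mul' _ _ hc]
    refine lintegral_mono fun z => ?_
    -- Only coordinates in `s` have been changed and `i ∉ s`, so the interval for coordinate `i`
    -- still starts at `x i`.
    have h := derivSum_le_lintegral_update hδ (m + s.card) hf i (Function.updateFinset x s z)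
    have hx : Function.updateFinset x s z i = x i := by simp [Function.updateFinset, hi]
    rw [hx] at h
    exact h

/-- A Sobolev inequality on balls. -/
theorem derivSum_le_lintegral_closedBall {δ : ℝ} (hδ : 0 < δ) (m : ℕ) {f : (Fin k → ℝ) → 𝕜}
    (hf : ContDiff ℝ ∞ f) (x : Fin k → ℝ) :
    derivSum m f x ≤ (2 * (ENNReal.ofReal δ⁻¹ + 1)) ^ k *
      ∫⁻ y in Metric.closedBall x δ, derivSum (m + k) f y := by
  have h := derivSum_le_lmarginal hδ m hf x Finset.univ
  rw [lmarginal_univ, Finset.card_univ, Fintype.card_fin, ← Measure.restrict_pi_pi] at h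
  refine h.trans ?_
  have hsub : (Set.univ.pi fun i => Set.Icc (x i) (x i + δ)) ⊆ Metric.closedBall x δ := by
    intro y hy
    rw [Metric.mem_closedBall, dist_pi_le_iff hδ.le]
    intro i
    have := hy i (Set.mem_univ i)
    rw [Real.dist_eq, abs_le]
    constructor <;> linarith [this.1, this.2]
  exact mul_le_mul_right (lintegral_mono_set hsub) _

theorem weight_mul_le_kpIntegrand_rpow {p : ℝ} (hp : 1 ≤ p) (γ : Γ) (m : ℕ)
    (f : (Fin k → ℝ) → 𝕜) (x : Fin k → ℝ) {μ : Fin k → ℕ} (hμ : μ ∈ multiIndices k m) :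
    M γ x * ‖multiDeriv μ f x‖ ≤ kpIntegrand M p γ m f x ^ (1 / p) := by
  have hp0 : 0 < p := by linarith
  have h0 : 0 ≤ M γ x * ‖multiDeriv μ f x‖ := mul_nonneg (M.nonneg _ _) (norm_nonneg _)
  rw [one_div, Real.le_rpow_inv_iff_of_pos h0 (kpIntegrand_nonneg M p γ m f x) hp0,
    kpIntegrand_eq_sum]
  exact Finset.single_le_sum (f := fun μ => (M γ x * ‖multiDeriv μ f x‖) ^ p)
    (fun ν _ => Real.rpow_nonneg (mul_nonneg (M.nonneg _ _) (norm_nonneg _)) _) hμ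

theorem kpNorm_nonneg (p : ℝ) (γ : Γ) (m : ℕ) (f : (Fin k → ℝ) → 𝕜) : 0 ≤ kpNorm M p γ m f :=
  Real.rpow_nonneg (integral_nonneg (kpIntegrand_nonneg M p γ m f)) _

/-- Hölder's inequality on a ball of the supremum norm, a cube of volume `(2 * δ) ^ k`. The bound
does not depend on the centre. -/
theorem lintegral_closedBall_le_kpNorm {p : ℝ} (hp : 1 ≤ p) {γ : Γ} {m : ℕ}
    {f : (Fin k → ℝ) → 𝕜} (hf : ContDiff ℝ ∞ f) (hf' : Integrable (kpIntegrand M p γ m f))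
    {δ : ℝ} (hδ : 0 < δ) (x : Fin k → ℝ) :
    ∫⁻ y in Metric.closedBall x δ, ENNReal.ofReal (kpIntegrand M p γ m f y ^ (1 / p)) ≤
      ENNReal.ofReal (kpNorm M p γ m f) * ENNReal.ofReal ((2 * δ) ^ k) ^ (1 - 1 / p) := by
  have hp0 : 0 < p := by linarith
  obtain ⟨hm, he⟩ := kpIntegrand_memLp M hp hf hf'
  set g := fun x => kpIntegrand M p γ m f x ^ (1 / p)
  have h1 : ∫⁻ y in Metric.closedBall x δ, ENNReal.ofReal (g y) =
      eLpNorm g 1 (volume.restrict (Metric.closedBall x δ)) := by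
    rw [eLpNorm_one_eq_lintegral_enorm]
    exact lintegral_congr fun y => (Real.enorm_of_nonneg
      (Real.rpow_nonneg (kpIntegrand_nonneg M p γ m f y) _)).symm
  have h2 := eLpNorm_le_eLpNorm_mul_rpow_measure_univ (p := 1) (q := ENNReal.ofReal p)
    (by simpa using hp) (f := g)
    (hm.1.restrict (s := Metric.closedBall x δ))
  rw [h1]
  refine h2.trans ?_
  rw [Measure.restrict_apply_univ, Real.volume_pi_closedBall x hδ.le, Fintype.card_fin,
    ENNReal.toReal_one, ENNReal.toReal_ofReal hp0.le, div_one, ← he]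
  gcongr
  exact Measure.restrict_le_self

/-- The Sobolev inequality is local, and (II) replaces `M γ x` by `c * M γ' y` throughout the ball
of integration. The loss of `k` orders comes from the Sobolev step; the constant is uniform in `x`.
-/
theorem supNorm_le_kpNorm (hII : M.CondII) {p : ℝ} (hp : 1 ≤ p) (γ : Γ) (m : ℕ) :
    ∃ (γ' : Γ) (C : ℝ), 0 ≤ C ∧ ∀ f : (Fin k → ℝ) → 𝕜, ContDiff ℝ ∞ f →
      Integrable (kpIntegrand M p γ' (m + k) f) →
      SupNormFinite M γ m f ∧ supNorm M γ m f ≤ C * kpNorm M p γ' (m + k) f := by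
  have hp0 : 0 < p := by linarith
  obtain ⟨γ', B, hB, c, hc, hMc⟩ := hII γ
  obtain ⟨δ, hδ, hδB⟩ := Metric.nhds_basis_closedBall.mem_iff.1 hB
  set N := (multiIndices k (m + k)).card
  set K : ENNReal := ENNReal.ofReal c * ((2 * (ENNReal.ofReal δ⁻¹ + 1)) ^ k *
    (N * ENNReal.ofReal ((2 * δ) ^ k) ^ (1 - 1 / p))) with hKdef
  have hK : K ≠ ⊤ := by
    have hexp : 0 ≤ 1 - 1 / p := by
      rw [sub_nonneg, div_le_one hp0]; exact hp
    refine ENNReal.mul_ne_top ENNReal.ofReal_ne_top (ENNReal.mul_ne_top (ENNReal.pow_ne_top ?_)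
      (ENNReal.mul_ne_top (ENNReal.natCast_ne_top _) (ENNReal.rpow_ne_top_of_nonneg hexp
        ENNReal.ofReal_ne_top)))
    simp [ENNReal.mul_eq_top]
  refine ⟨γ', K.toReal, ENNReal.toReal_nonneg, fun f hf hf' => supNorm_le fun x μ hμ => ?_⟩
  set g := fun x => kpIntegrand M p γ' (m + k) f x ^ (1 / p)
  have hpt : ∀ y ∈ Metric.closedBall x δ, ENNReal.ofReal (M γ x) * derivSum (m + k) f y ≤
      ENNReal.ofReal c * (N * ENNReal.ofReal (g y)) := by
    intro y hy
    have hxy : M γ x ≤ c * M γ' y := by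
      have := hMc x (y - x) (hδB (by simpa [dist_eq_norm] using hy))
      rwa [add_sub_cancel] at this
    calc ENNReal.ofReal (M γ x) * derivSum (m + k) f y
        ≤ ENNReal.ofReal (c * M γ' y) * derivSum (m + k) f y := by gcongr
      _ = ENNReal.ofReal c * ∑ ν ∈ multiIndices k (m + k),
          ENNReal.ofReal (M γ' y * ‖multiDeriv ν f y‖) := by
          rw [derivSum, ENNReal.ofReal_mul hc.le, mul_assoc, Finset.mul_sum]
          congr 1
          refine Finset.sum_congr rfl fun ν _ => ?_
          rw [ENNReal.ofReal_mul (M.nonneg _ _), ofReal_norm]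
      _ ≤ ENNReal.ofReal c * ∑ _ν ∈ multiIndices k (m + k), ENNReal.ofReal (g y) := by
          gcongr with ν hν
          exact weight_mul_le_kpIntegrand_rpow hp γ' (m + k) f y hν
      _ = _ := by rw [Finset.sum_const, nsmul_eq_mul]
  have hmain : ENNReal.ofReal (M γ x * ‖multiDeriv μ f x‖) ≤
      ENNReal.ofReal (K.toReal * kpNorm M p γ' (m + k) f) := by
    calc ENNReal.ofReal (M γ x * ‖multiDeriv μ f x‖)
        ≤ ENNReal.ofReal (M γ x) * derivSum m f x := by
          rw [ENNReal.ofReal_mul (M.nonneg _ _), ofReal_norm]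
          gcongr
          exact Finset.single_le_sum (f := fun μ => ‖multiDeriv μ f x‖ₑ)
            (fun _ _ => zero_le) hμ
      _ ≤ ENNReal.ofReal (M γ x) * ((2 * (ENNReal.ofReal δ⁻¹ + 1)) ^ k *
          ∫⁻ y in Metric.closedBall x δ, derivSum (m + k) f y) := by
          gcongr
          exact derivSum_le_lintegral_closedBall hδ m hf x
      _ = (2 * (ENNReal.ofReal δ⁻¹ + 1)) ^ k *
          ∫⁻ y in Metric.closedBall x δ, ENNReal.ofReal (M γ x) * derivSum (m + k) f y := by
          rw [lintegral_const_mul _ (measurable_derivSum _ hf)]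
          ring
      _ ≤ (2 * (ENNReal.ofReal δ⁻¹ + 1)) ^ k *
          ∫⁻ y in Metric.closedBall x δ, ENNReal.ofReal c * (N * ENNReal.ofReal (g y)) := by
          refine mul_le_mul_right ?_ _
          exact setLIntegral_mono' Metric.isClosed_closedBall.measurableSet hpt
      _ = (2 * (ENNReal.ofReal δ⁻¹ + 1)) ^ k * (ENNReal.ofReal c * (N *
          ∫⁻ y in Metric.closedBall x δ, ENNReal.ofReal (g y))) := by
          rw [lintegral_const_mul' _ _ ENNReal.ofReal_ne_top,
            lintegral_const_mul' _ _ (ENNReal.natCast_ne_top N)]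
      _ ≤ (2 * (ENNReal.ofReal δ⁻¹ + 1)) ^ k * (ENNReal.ofReal c * (N *
          (ENNReal.ofReal (kpNorm M p γ' (m + k) f) *
            ENNReal.ofReal ((2 * δ) ^ k) ^ (1 - 1 / p)))) := by
          gcongr
          exact lintegral_closedBall_le_kpNorm hp hf hf' hδ x
      _ = K * ENNReal.ofReal (kpNorm M p γ' (m + k) f) := by rw [hKdef]; ring
      _ = _ := by rw [ENNReal.ofReal_mul ENNReal.toReal_nonneg, ENNReal.ofReal_toReal hK]
  exact (ENNReal.ofReal_le_ofReal_iff
    (mul_nonneg ENNReal.toReal_nonneg (kpNorm_nonneg _ _ _ _))).1 hmain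

theorem KSubmodule_eq_KpSubmodule (hI : M.CondI) (hII : M.CondII) {p : ℝ} (hp : 1 ≤ p) :
    KSubmodule 𝕜 M = KpSubmodule 𝕜 M hp := by
  ext f
  constructor
  · rintro ⟨hf, h⟩
    refine ⟨hf, fun γ m => ?_⟩
    obtain ⟨γ', C, -, hC⟩ := kpNorm_le_supNorm (𝕜 := 𝕜) hI hp γ m
    exact (hC f hf (h γ' m)).1
  · rintro ⟨hf, h⟩
    refine ⟨hf, fun γ m => ?_⟩
    obtain ⟨γ', C, -, hC⟩ := supNorm_le_kpNorm (𝕜 := 𝕜) hII hp γ m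
    exact (hC f hf (h γ' _)).1

/-- The identity map from `K(M)` to `K_p(M)` as a linear equivalence. -/
noncomputable def kSpaceLinearEquiv (𝕜 : Type*) [RCLike 𝕜] (hI : M.CondI) (hII : M.CondII)
    {p : ℝ} (hp : 1 ≤ p) : KSpace 𝕜 M ≃ₗ[𝕜] KpSpace 𝕜 M hp :=
  LinearEquiv.ofEq (KSubmodule 𝕜 M) (KpSubmodule 𝕜 M hp) (KSubmodule_eq_KpSubmodule hI hII hp)

theorem continuous_kSpaceLinearEquiv (hI : M.CondI) (hII : M.CondII) {p : ℝ} (hp : 1 ≤ p) :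
    Continuous (kSpaceLinearEquiv 𝕜 hI hII hp) := by
  refine (kSpace_withSeminorms 𝕜 M).continuous_of_isBounded (kpSpace_withSeminorms 𝕜 M hp)
    (kSpaceLinearEquiv 𝕜 hI hII hp).toLinearMap fun i => ?_
  obtain ⟨γ', C, hC0, hC⟩ := kpNorm_le_supNorm (𝕜 := 𝕜) hI hp i.1 i.2
  refine ⟨{(γ', i.2)}, ⟨C, hC0⟩, fun f => ?_⟩
  rw [Finset.sup_singleton]
  exact (hC f.toFun f.2.1 (f.2.2 γ' i.2)).2

theorem continuous_kSpaceLinearEquiv_symm (hI : M.CondI) (hII : M.CondII) {p : ℝ} (hp : 1 ≤ p) :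
    Continuous (kSpaceLinearEquiv 𝕜 hI hII hp).symm := by
  refine (kpSpace_withSeminorms 𝕜 M hp).continuous_of_isBounded (kSpace_withSeminorms 𝕜 M)
    (kSpaceLinearEquiv 𝕜 hI hII hp).symm.toLinearMap fun i => ?_
  obtain ⟨γ', C, hC0, hC⟩ := supNorm_le_kpNorm (𝕜 := 𝕜) hII hp i.1 i.2
  refine ⟨{(γ', i.2 + k)}, ⟨C, hC0⟩, fun f => ?_⟩
  rw [Finset.sup_singleton]
  exact (hC f.toFun f.2.1 (f.2.2 γ' (i.2 + k))).2

/-- The identity map from `K(M)` to `K_p(M)` as a topological isomorphism. -/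
noncomputable def kSpaceEquiv (𝕜 : Type*) [RCLike 𝕜] (hI : M.CondI) (hII : M.CondII)
    {p : ℝ} (hp : 1 ≤ p) : KSpace 𝕜 M ≃L[𝕜] KpSpace 𝕜 M hp where
  toLinearEquiv := kSpaceLinearEquiv 𝕜 hI hII hp
  continuous_toFun := continuous_kSpaceLinearEquiv hI hII hp
  continuous_invFun := continuous_kSpaceLinearEquiv_symm hI hII hp

end Comparison

/-! ### Metrizability and completeness of `K(M)` -/

section Frechet

variable {𝕜 : Type*} [RCLike 𝕜] {k : ℕ} {Γ : Type*} {M : DefiningFamily k Γ}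

theorem supNorm_mono {γ γ' : Γ} {m m' : ℕ} {A : ℝ} (hA : 0 ≤ A) (hm : m ≤ m')
    (h : ∀ x, M γ x ≤ A * M γ' x) {f : (Fin k → ℝ) → 𝕜} (hf : SupNormFinite M γ' m' f) :
    supNorm M γ m f ≤ A * supNorm M γ' m' f := by
  refine (supNorm_le fun x μ hμ => ?_).2
  calc M γ x * ‖multiDeriv μ f x‖ ≤ A * M γ' x * ‖multiDeriv μ f x‖ :=
        mul_le_mul_of_nonneg_right (h x) (norm_nonneg _)
    _ = A * (M γ' x * ‖multiDeriv μ f x‖) := mul_assoc _ _ _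
    _ ≤ _ := mul_le_mul_of_nonneg_left (le_supNorm hf x (multiIndices_mono k hm hμ)) hA

/-- The seminorms with weights from the countable cofinal set already generate the topology. -/
theorem firstCountableTopology_kSpace : FirstCountableTopology (KSpace 𝕜 M) := by
  obtain ⟨Γ', hΓ', h⟩ := M.countable_cofinal
  have : Countable Γ' := hΓ'
  let q : SeminormFamily 𝕜 (KSpace 𝕜 M) (Γ' × ℕ) := fun i => kSeminorm 𝕜 M (i.1, i.2)
  have hq : WithSeminorms q := by
    refine (kSpace_withSeminorms 𝕜 M).congr (fun i => ?_) (fun i => ?_)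
    · exact ⟨{((i.1 : Γ), i.2)}, 1, by simp [q]⟩
    · obtain ⟨γ', hγ', C, hC, hle⟩ := h i.1
      refine ⟨{(⟨γ', hγ'⟩, i.2)}, ⟨C⁻¹, by positivity⟩, fun f => ?_⟩
      rw [Finset.sup_singleton]
      exact supNorm_mono (by positivity) le_rfl
        (fun x => (le_inv_mul_iff₀ hC).2 (hle x)) (f.2.2 γ' i.2)
  exact hq.firstCountableTopology

theorem t2Space_kSpace : T2Space (KSpace 𝕜 M) := by
  have : T1Space (KSpace 𝕜 M) := by
    refine (kSpace_withSeminorms 𝕜 M).T1_of_separating fun f hf => ?_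
    have hx : ∃ x, f.toFun x ≠ 0 := by
      by_contra! hx
      exact hf (Subtype.ext (funext hx))
    obtain ⟨x, hx⟩ := hx
    obtain ⟨γ, U, hU, c, hc, hM⟩ := M.locally_pos x
    refine ⟨(γ, 0), ne_of_gt ?_⟩
    have h := le_supNorm (f.2.2 γ 0) x (mem_multiIndices.2 (by simp : ∑ i, (0 : Fin k → ℕ) i ≤ 0))
    rw [multiDeriv_zero_index] at h
    exact (mul_pos (hc.trans_le (hM x (mem_of_mem_nhds hU))) (norm_pos_iff.2 hx)).trans_le h
  infer_instance

theorem multiIndex_induction {P : (Fin k → ℕ) → Prop} (zero : P 0)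
    (add_single : ∀ μ i, P μ → P (μ + Pi.single i 1)) (μ : Fin k → ℕ) : P μ := by
  induction h : ∑ i, μ i generalizing μ with
  | zero =>
    have : μ = 0 := by
      funext i
      exact (Finset.sum_eq_zero_iff.1 h) i (Finset.mem_univ i)
    rwa [this]
  | succ n ih =>
    have hi : ∃ i, μ i ≠ 0 := by
      by_contra! hi
      simp [hi] at h
    obtain ⟨i, hi⟩ := hi
    have hle : (Pi.single i 1 : Fin k → ℕ) ≤ μ := by
      intro j
      by_cases hj : j = i
      · subst hj
        simpa using Nat.one_le_iff_ne_zero.2 hi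
      · simp [hj]
    have hμ := tsub_add_cancel_of_le hle
    rw [← hμ]
    refine add_single _ i (ih _ ?_)
    have h' := sum_add_single (μ - Pi.single i 1) i
    rw [hμ, h] at h'
    exact (Nat.succ_injective h').symm

theorem hasFDerivAt_sum_partialDeriv {f : (Fin k → ℝ) → 𝕜} (hf : ContDiff ℝ ∞ f)
    (x : Fin k → ℝ) : HasFDerivAt f
      (∑ i, ContinuousLinearMap.smulRightL ℝ (Fin k → ℝ) 𝕜
        (ContinuousLinearMap.proj (R := ℝ) (φ := fun _ : Fin k => ℝ) i) (partialDeriv i f x)) x := by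
  have h := (hf.differentiable (by simp) x).hasFDerivAt
  rw [fderiv_eq_sum_partialDeriv hf] at h
  exact h

/-- If all derivatives of a sequence of smooth functions converge locally uniformly, the limit is
smooth and its derivatives are the limits of the derivatives. -/
theorem contDiff_of_tendstoLocallyUniformlyOn_multiDeriv {u : ℕ → (Fin k → ℝ) → 𝕜}
    (hu : ∀ n, ContDiff ℝ ∞ (u n)) {g : (Fin k → ℕ) → (Fin k → ℝ) → 𝕜}
    (h : ∀ μ, TendstoLocallyUniformlyOn (fun n => multiDeriv μ (u n)) (g μ) atTop Set.univ) :
    ContDiff ℝ ∞ (g 0) ∧ ∀ μ, multiDeriv μ (g 0) = g μ := by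
  let T : Fin k → 𝕜 →L[ℝ] ((Fin k → ℝ) →L[ℝ] 𝕜) := fun i =>
    ContinuousLinearMap.smulRightL ℝ (Fin k → ℝ) 𝕜
      (ContinuousLinearMap.proj (R := ℝ) (φ := fun _ : Fin k => ℝ) i)
  -- Termwise differentiation: the first partial derivatives of `g μ` are the limits with index
  -- raised by one, so the family `g` is closed under differentiation.
  have hder : ∀ μ x, HasFDerivAt (g μ) (∑ i, T i (g (μ + Pi.single i 1) x)) x := by
    intro μ x
    have hsum : ∀ s : Finset (Fin k), TendstoLocallyUniformlyOn
        (fun n x => ∑ i ∈ s, T i (multiDeriv (μ + Pi.single i 1) (u n) x))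
        (fun x => ∑ i ∈ s, T i (g (μ + Pi.single i 1) x)) atTop Set.univ := by
      intro s
      induction s using Finset.induction_on with
      | empty =>
        simp only [Finset.sum_empty]
        intro v hv y _
        exact ⟨Set.univ, univ_mem, Eventually.of_forall fun n z _ => refl_mem_uniformity hv⟩
      | insert i s hi ih =>
        simp only [Finset.sum_insert hi]
        exact ((T i).uniformContinuous.comp_tendstoLocallyUniformlyOn
          (h (μ + Pi.single i 1))).add ih
    refine hasFDerivAt_of_tendstoLocallyUniformlyOn isOpen_univ (hsum Finset.univ)
      (f := fun n => multiDeriv μ (u n)) (fun n y _ => ?_)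
      (fun y hy => (h μ).tendsto_at hy) (Set.mem_univ x)
    have h1 := hasFDerivAt_sum_partialDeriv (contDiff_multiDeriv μ (hu n)) y
    simpa only [partialDeriv_multiDeriv _ μ (hu n)] using h1
  -- The induction treats all `μ` at once, because the derivative of `g μ` involves the other
  -- members of the family.
  have hsm : ∀ (n : ℕ) μ, ContDiff ℝ n (g μ) := by
    intro n
    induction n with
    | zero =>
      intro μ
      exact contDiff_zero.2 (continuous_iff_continuousAt.2 fun x => (hder μ x).continuousAt)
    | succ n ih =>
      intro μ
      rw [Nat.cast_succ, contDiff_succ_iff_hasFDerivAt]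
      exact ⟨_, ContDiff.sum fun i _ => (T i).contDiff.comp (ih _), hder μ⟩
  have h0 : ContDiff ℝ ∞ (g 0) := contDiff_infty.2 fun n => hsm n 0
  refine ⟨h0, fun μ => ?_⟩
  induction μ using multiIndex_induction with
  | zero => exact multiDeriv_zero_index _
  | add_single μ i ih =>
    rw [← partialDeriv_multiDeriv i μ h0, ih,
      partialDeriv_eq_fderiv i (contDiff_infty.2 fun n => hsm n μ)]
    funext x
    rw [(hder μ x).fderiv, _root_.sum_apply, Finset.sum_eq_single i]
    · simp [T]
    · intro j _ hj
      simp [T, hj]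
    · simp

theorem exists_forall_kSeminorm_sub_lt {u : ℕ → KSpace 𝕜 M} (hu : CauchySeq u) (i : Γ × ℕ)
    {ε : ℝ} (hε : 0 < ε) : ∃ N, ∀ a ≥ N, ∀ b ≥ N, kSeminorm 𝕜 M i (u a - u b) < ε := by
  have hV : {f : KSpace 𝕜 M | kSeminorm 𝕜 M i f < ε} ∈ 𝓝 (0 : KSpace 𝕜 M) := by
    refine (isOpen_lt ((kSpace_withSeminorms 𝕜 M).continuous_seminorm i)
      continuous_const).mem_nhds ?_
    simpa using hε
  have hW : {q : KSpace 𝕜 M × KSpace 𝕜 M | kSeminorm 𝕜 M i (q.1 - q.2) < ε} ∈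
      uniformity (KSpace 𝕜 M) := by
    rw [uniformity_eq_comap_nhds_zero_swapped]
    exact preimage_mem_comap hV
  obtain ⟨N, hN⟩ := cauchySeq_iff.1 hu _ hW
  exact ⟨N, fun a ha b hb => hN a ha b hb⟩

theorem weight_mul_norm_sub_le (i : Γ × ℕ) (f g : KSpace 𝕜 M) {μ : Fin k → ℕ}
    (hμ : μ ∈ multiIndices k i.2) (x : Fin k → ℝ) :
    M i.1 x * ‖multiDeriv μ f.toFun x - multiDeriv μ g.toFun x‖ ≤ kSeminorm 𝕜 M i (f - g) := by
  have h := le_supNorm ((f - g).2.2 i.1 i.2) x hμ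
  have h2 : multiDeriv μ (f - g).toFun = multiDeriv μ f.toFun - multiDeriv μ g.toFun :=
    multiDeriv_sub μ f.2.1 g.2.1
  change M i.1 x * ‖multiDeriv μ (f - g).toFun x‖ ≤ _ at h
  rwa [h2] at h

/-- Near each point some weight is bounded below by a positive constant, so a seminorm of order
`|μ|` controls the uniform norm of `∂^μ` there. -/
theorem exists_tendstoLocallyUniformlyOn_multiDeriv {u : ℕ → KSpace 𝕜 M} (hu : CauchySeq u)
    (μ : Fin k → ℕ) : ∃ g : (Fin k → ℝ) → 𝕜,
      TendstoLocallyUniformlyOn (fun n => multiDeriv μ (u n).toFun) g atTop Set.univ := by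
  have hμ : μ ∈ multiIndices k (∑ i, μ i) := mem_multiIndices.2 le_rfl
  have hloc : ∀ x, ∃ U ∈ 𝓝 x, UniformCauchySeqOn (fun n => multiDeriv μ (u n).toFun) atTop U := by
    intro x
    obtain ⟨γ, U, hU, c, hc, hM⟩ := M.locally_pos x
    refine ⟨U, hU, Metric.uniformCauchySeqOn_iff.2 fun ε hε => ?_⟩
    obtain ⟨N, hN⟩ := exists_forall_kSeminorm_sub_lt hu (γ, ∑ i, μ i) (mul_pos hc hε)
    refine ⟨N, fun a ha b hb y hy => ?_⟩
    have h1 := weight_mul_norm_sub_le (γ, ∑ i, μ i) (u a) (u b) hμ y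
    have h2 := hN a ha b hb
    rw [dist_eq_norm]
    have h3 : c * ‖multiDeriv μ (u a).toFun y - multiDeriv μ (u b).toFun y‖ ≤
        M γ y * ‖multiDeriv μ (u a).toFun y - multiDeriv μ (u b).toFun y‖ :=
      mul_le_mul_of_nonneg_right (hM y hy) (norm_nonneg _)
    exact lt_of_mul_lt_mul_left (h3.trans_lt (h1.trans_lt h2)) hc.le
  have hpt : ∀ x, ∃ y, Tendsto (fun n => multiDeriv μ (u n).toFun x) atTop (𝓝 y) := by
    intro x
    obtain ⟨U, hU, h⟩ := hloc x
    exact cauchySeq_tendsto_of_complete (h.cauchySeq (mem_of_mem_nhds hU))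
  choose g hg using hpt
  refine ⟨g, fun v hv x _ => ?_⟩
  obtain ⟨U, hU, h⟩ := hloc x
  refine ⟨U, mem_nhdsWithin_of_mem_nhds hU, ?_⟩
  exact h.tendstoUniformlyOn_of_tendsto (fun y _ => hg y) v hv

theorem completeSpace_kSpace : CompleteSpace (KSpace 𝕜 M) := by
  have := firstCountableTopology_kSpace (𝕜 := 𝕜) (M := M)
  have : (uniformity (KSpace 𝕜 M)).IsCountablyGenerated :=
    IsUniformAddGroup.uniformity_countably_generated
  refine UniformSpace.complete_of_cauchySeq_tendsto fun u hu => ?_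
  choose g hg using exists_tendstoLocallyUniformlyOn_multiDeriv hu
  obtain ⟨hsm, hD⟩ := contDiff_of_tendstoLocallyUniformlyOn_multiDeriv (fun n => (u n).2.1) hg
  -- In the Cauchy estimate the second index tends to infinity with `x` fixed. Pointwise convergence
  -- suffices, and `N` stays independent of `x`.
  have hlim : ∀ (i : Γ × ℕ) (ε : ℝ), 0 < ε → ∃ N, ∀ n ≥ N, ∀ x, ∀ μ ∈ multiIndices k i.2,
      M i.1 x * ‖multiDeriv μ (u n).toFun x - g μ x‖ ≤ ε := by
    intro i ε hε
    obtain ⟨N, hN⟩ := exists_forall_kSeminorm_sub_lt hu i hε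
    refine ⟨N, fun n hn x μ hμ => ?_⟩
    have ht := (((hg μ).tendsto_at (Set.mem_univ x)).const_sub
      (multiDeriv μ (u n).toFun x)).norm.const_mul (M i.1 x)
    refine le_of_tendsto ht (eventually_atTop.2 ⟨N, fun b hb => ?_⟩)
    exact (weight_mul_norm_sub_le i (u n) (u b) hμ x).trans (hN n hn b hb).le
  have hfin : ∀ γ m, SupNormFinite M γ m (g 0) := by
    intro γ m
    obtain ⟨N, hN⟩ := hlim (γ, m) 1 one_pos
    refine (supNorm_le (A := 1 + supNorm M γ m (u N).toFun) fun x μ hμ => ?_).1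
    have h1 := hN N le_rfl x μ hμ
    have h2 := le_supNorm ((u N).2.2 γ m) x hμ
    rw [hD]
    have h3 : ‖g μ x‖ ≤ ‖multiDeriv μ (u N).toFun x - g μ x‖ + ‖multiDeriv μ (u N).toFun x‖ := by
      rw [norm_sub_rev]
      simpa using norm_add_le (g μ x - multiDeriv μ (u N).toFun x) (multiDeriv μ (u N).toFun x)
    calc M γ x * ‖g μ x‖ ≤ M γ x * (‖multiDeriv μ (u N).toFun x - g μ x‖ +
          ‖multiDeriv μ (u N).toFun x‖) := mul_le_mul_of_nonneg_left h3 (M.nonneg _ _)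
      _ ≤ _ := by rw [mul_add]; exact add_le_add h1 h2
  let f : KSpace 𝕜 M := ⟨g 0, hsm, hfin⟩
  refine ⟨f, ((kSpace_withSeminorms 𝕜 M).tendsto_nhds_atTop u f).2 fun i ε hε => ?_⟩
  -- The limit estimate is not strict; halving `ε` recovers a strict inequality after taking the
  -- supremum.
  obtain ⟨N, hN⟩ := hlim i (ε / 2) (by positivity)
  refine ⟨N, fun n hn => lt_of_le_of_lt ?_ (half_lt_self hε)⟩
  refine (supNorm_le fun x μ hμ => ?_).2
  have h2 : multiDeriv μ (u n - f).toFun = multiDeriv μ (u n).toFun - multiDeriv μ (g 0) :=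
    multiDeriv_sub μ (u n).2.1 hsm
  rw [h2, hD]
  exact hN n hn x μ hμ

theorem isFrechetSpace_kSpace : IsFrechetSpace 𝕜 (KSpace 𝕜 M) where
  isUniformAddGroup := inferInstance
  continuousSMul := (kSpace_withSeminorms 𝕜 M).continuousSMul
  locallyConvex := (kSpace_withSeminorms 𝕜 M).toPolynormableSpace
  hausdorff := t2Space_kSpace
  countable_basis := by
    have := firstCountableTopology_kSpace (𝕜 := 𝕜) (M := M)
    infer_instance
  complete := completeSpace_kSpace

end Frechet

/-! ### Nuclearity of `K(M)` -/

section NuclearKSpace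

variable {𝕜 : Type*} [RCLike 𝕜] {k : ℕ} {Γ : Type*} {M : DefiningFamily k Γ}

open scoped NNReal

theorem IsHilbertSeminorm.smul {F : Type*} [AddCommGroup F] [Module 𝕜 F] {q : Seminorm 𝕜 F}
    (hq : IsHilbertSeminorm q) (c : ℝ≥0) : IsHilbertSeminorm (c • q) := by
  intro f g
  have h := hq f g
  simp only [_root_.smul_apply, NNReal.smul_def, smul_eq_mul, mul_pow]
  linear_combination (c : ℝ) ^ 2 * h

/-- The seminorm `‖·‖²_{γ,m}` of `K_2(M)`, on `K(M)`. -/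
noncomputable def hilbertSeminorm (𝕜 : Type*) [RCLike 𝕜] (hI : M.CondI) (hII : M.CondII) (γ : Γ)
    (m : ℕ) : Seminorm 𝕜 (KSpace 𝕜 M) :=
  (kpSeminorm 𝕜 M one_le_two (γ, m)).comp (kSpaceLinearEquiv 𝕜 hI hII one_le_two).toLinearMap

theorem continuous_hilbertSeminorm (hI : M.CondI) (hII : M.CondII) (γ : Γ) (m : ℕ) :
    Continuous (hilbertSeminorm 𝕜 hI hII γ m) :=
  ((kpSpace_withSeminorms 𝕜 M one_le_two).continuous_seminorm (γ, m)).comp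
    (continuous_kSpaceLinearEquiv hI hII one_le_two)

theorem integrable_kpIntegrand_two (hI : M.CondI) (hII : M.CondII) (γ : Γ) (m : ℕ)
    (f : KSpace 𝕜 M) : Integrable (kpIntegrand M 2 γ m f.toFun) :=
  ((kSpaceLinearEquiv 𝕜 hI hII one_le_two) f).2.2 γ m

theorem hilbertSeminorm_sq (hI : M.CondI) (hII : M.CondII) (γ : Γ) (m : ℕ) (f : KSpace 𝕜 M) :
    hilbertSeminorm 𝕜 hI hII γ m f ^ 2 = ∫ x, kpIntegrand M 2 γ m f.toFun x := by
  change kpNorm M 2 γ m f.toFun ^ 2 = _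
  rw [kpNorm, ← Real.sqrt_eq_rpow, Real.sq_sqrt (integral_nonneg (kpIntegrand_nonneg M 2 γ m _))]

theorem kpIntegrand_two (γ : Γ) (m : ℕ) (f : (Fin k → ℝ) → 𝕜) (x : Fin k → ℝ) :
    kpIntegrand M 2 γ m f x = ∑ μ ∈ multiIndices k m, M γ x ^ 2 * ‖multiDeriv μ f x‖ ^ 2 := by
  simp only [kpIntegrand_eq_sum, Real.rpow_two, mul_pow]

theorem isHilbertSeminorm_hilbertSeminorm (hI : M.CondI) (hII : M.CondII) (γ : Γ) (m : ℕ) :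
    IsHilbertSeminorm (hilbertSeminorm 𝕜 hI hII γ m) := by
  intro f g
  have hint := integrable_kpIntegrand_two (𝕜 := 𝕜) hI hII γ m
  simp only [hilbertSeminorm_sq]
  rw [← integral_add (hint _) (hint _), ← integral_add (hint _) (hint _), ← integral_const_mul]
  refine integral_congr_ae (ae_of_all _ fun x => ?_)
  simp only [kpIntegrand_two]
  rw [← Finset.sum_add_distrib, ← Finset.sum_add_distrib, Finset.mul_sum]
  refine Finset.sum_congr rfl fun μ _ => ?_
  have h1 : multiDeriv μ (f + g).toFun = multiDeriv μ f.toFun + multiDeriv μ g.toFun :=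
    multiDeriv_add μ f.2.1 g.2.1
  have h2 : multiDeriv μ (f - g).toFun = multiDeriv μ f.toFun - multiDeriv μ g.toFun :=
    multiDeriv_sub μ f.2.1 g.2.1
  rw [h1, h2]
  have h3 := parallelogram_law_with_norm 𝕜 (multiDeriv μ f.toFun x) (multiDeriv μ g.toFun x)
  simp only [Pi.add_apply, Pi.sub_apply]
  linear_combination M γ x ^ 2 * h3

/-- Directedness of the weights, together with the larger of the two orders, merges two seminorms
into one. -/
theorem exists_sup_kSeminorm_le (s : Finset (Γ × ℕ)) :
    ∃ (i : Γ × ℕ) (C : ℝ≥0), s.sup (kSeminorm 𝕜 M) ≤ C • kSeminorm 𝕜 M i := by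
  classical
  induction s using Finset.induction_on with
  | empty =>
    -- Local positivity at one point shows that `Γ` is nonempty.
    obtain ⟨γ, -⟩ := M.locally_pos 0
    exact ⟨(γ, 0), 0, by simp⟩
  | insert j s hj ih =>
    obtain ⟨i, C, hC⟩ := ih
    obtain ⟨γ, c, hc, h⟩ := M.directed i.1 j.1
    let c' : ℝ≥0 := ⟨c⁻¹, by positivity⟩
    have hi : kSeminorm 𝕜 M i ≤ c' • kSeminorm 𝕜 M (γ, max i.2 j.2) := fun f =>
      supNorm_mono (by positivity) (le_max_left _ _)
        (fun x => (le_inv_mul_iff₀ hc).2 (by nlinarith [h x, M.nonneg j.1 x])) (f.2.2 _ _)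
    have hj : kSeminorm 𝕜 M j ≤ c' • kSeminorm 𝕜 M (γ, max i.2 j.2) := fun f =>
      supNorm_mono (by positivity) (le_max_right _ _)
        (fun x => (le_inv_mul_iff₀ hc).2 (by nlinarith [h x, M.nonneg i.1 x])) (f.2.2 _ _)
    refine ⟨(γ, max i.2 j.2), max c' (C * c'), ?_⟩
    rw [Finset.sup_insert]
    refine sup_le (fun f => (hj f).trans ?_) (fun f => (hC f).trans ?_)
    · exact mul_le_mul_of_nonneg_right (NNReal.coe_le_coe.2 (le_max_left _ _)) (apply_nonneg _ _)
    · calc (C • kSeminorm 𝕜 M i) f ≤ C * (c' * kSeminorm 𝕜 M (γ, max i.2 j.2) f) :=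
            mul_le_mul_of_nonneg_left (hi f) C.2
        _ = ((C * c' : ℝ≥0) : ℝ) * kSeminorm 𝕜 M (γ, max i.2 j.2) f := by push_cast; ring
        _ ≤ _ := mul_le_mul_of_nonneg_right (NNReal.coe_le_coe.2 (le_max_right _ _))
            (apply_nonneg _ _)

theorem exists_kSeminorm_le_hilbertSeminorm (hI : M.CondI) (hII : M.CondII) (i : Γ × ℕ) :
    ∃ (γ : Γ) (m : ℕ) (C : ℝ≥0), kSeminorm 𝕜 M i ≤ C • hilbertSeminorm 𝕜 hI hII γ m := by
  obtain ⟨γ', C, hC0, hC⟩ := supNorm_le_kpNorm (𝕜 := 𝕜) hII one_le_two i.1 i.2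
  exact ⟨γ', i.2 + k, ⟨C, hC0⟩, fun f =>
    (hC f.toFun f.2.1 (integrable_kpIntegrand_two hI hII _ _ f)).2⟩

/-- Up to constants, the Hilbert seminorms are cofinal among the continuous ones; this is the
comparison of `K(M)` with `K_p(M)` at `p = 2`. -/
theorem exists_le_hilbertSeminorm (hI : M.CondI) (hII : M.CondII) (p : Seminorm 𝕜 (KSpace 𝕜 M))
    (hp : Continuous p) :
    ∃ (γ : Γ) (m : ℕ) (C : ℝ≥0), p ≤ C • hilbertSeminorm 𝕜 hI hII γ m := by
  obtain ⟨s, C, -, hC⟩ := Seminorm.bound_of_continuous (kSpace_withSeminorms 𝕜 M) p hp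
  obtain ⟨i, C', hC'⟩ := exists_sup_kSeminorm_le (𝕜 := 𝕜) (M := M) s
  obtain ⟨γ, m, C'', hC''⟩ := exists_kSeminorm_le_hilbertSeminorm (𝕜 := 𝕜) hI hII i
  refine ⟨γ, m, C * (C' * C''), fun f => (hC f).trans ?_⟩
  calc (C • s.sup (kSeminorm 𝕜 M)) f ≤ C * (C' * (C'' * hilbertSeminorm 𝕜 hI hII γ m f)) :=
        mul_le_mul_of_nonneg_left ((hC' f).trans (mul_le_mul_of_nonneg_left (hC'' f) C'.2)) C.2
    _ = ((C * (C' * C'') : ℝ≥0) : ℝ) * hilbertSeminorm 𝕜 hI hII γ m f := by push_cast; ring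

theorem toFun_sum {n : ℕ} (a : Fin n → 𝕜) (f : Fin n → KSpace 𝕜 M) :
    (∑ j, a j • f j).toFun = ∑ j, a j • (f j).toFun := by
  change (KSubmodule 𝕜 M).subtype (∑ j, a j • f j : KSpace 𝕜 M) = _
  erw [map_sum]
  rfl

/-- A weakly `2`-bounded family is `2`-bounded pointwise. -/
theorem sum_norm_multiDeriv_sq_le {q : Seminorm 𝕜 (KSpace 𝕜 M)} {i : Γ × ℕ}
    (hq : kSeminorm 𝕜 M i ≤ q) {n : ℕ} (f : Fin n → KSpace 𝕜 M) {K : ℝ} (hK : 0 ≤ K)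
    (h : ∀ a : Fin n → 𝕜, q (∑ j, a j • f j) ^ 2 ≤ K * ∑ j, ‖a j‖ ^ 2) (x : Fin k → ℝ)
    {μ : Fin k → ℕ} (hμ : μ ∈ multiIndices k i.2) :
    M i.1 x ^ 2 * ∑ j, ‖multiDeriv μ (f j).toFun x‖ ^ 2 ≤ K := by
  set d := fun j => multiDeriv μ (f j).toFun x
  set S := ∑ j, ‖d j‖ ^ 2
  have hS : 0 ≤ S := Finset.sum_nonneg fun _ _ => sq_nonneg _
  -- With conjugate coefficients the derivative of the combination at `x` equals `S`, while `∑ ‖a j‖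
  -- ^ 2` is also `S`. The hypothesis then reads `(M S) ^ 2 ≤ K S`, and one factor `S` cancels
  -- unless it vanishes.
  let a : Fin n → 𝕜 := fun j => star (d j)
  have h1 : multiDeriv μ (∑ j, a j • f j).toFun x = ((S : ℝ) : 𝕜) := by
    rw [toFun_sum, (multiDeriv_sum Finset.univ μ a (fun j => (f j).toFun) fun j => (f j).2.1).2]
    simp only [Finset.sum_apply, Pi.smul_apply, smul_eq_mul, S, RCLike.ofReal_sum,
      RCLike.ofReal_pow]
    exact Finset.sum_congr rfl fun j _ => RCLike.conj_mul _
  have h2 : M i.1 x * S ≤ q (∑ j, a j • f j) := by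
    have h3 := le_supNorm ((∑ j, a j • f j : KSpace 𝕜 M).2.2 i.1 i.2) x hμ
    change M i.1 x * ‖multiDeriv μ (∑ j, a j • f j).toFun x‖ ≤ _ at h3
    rw [h1, RCLike.norm_ofReal, abs_of_nonneg hS] at h3
    exact h3.trans (hq _)
  have h4 : (M i.1 x * S) ^ 2 ≤ K * S := by
    refine (pow_le_pow_left₀ (mul_nonneg (M.nonneg _ _) hS) h2 2).trans ((h a).trans_eq ?_)
    simp [a, S]
  rcases hS.eq_or_lt with h0 | h0
  · rw [← h0, mul_zero]; exact hK
  · refine le_of_mul_le_mul_right ?_ h0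
    calc M i.1 x ^ 2 * S * S = (M i.1 x * S) ^ 2 := by ring
      _ ≤ _ := h4

/-- The pointwise bound `M_γ₁ ^ 2 ∑ |∂^μ f_j| ^ 2 ≤ K` is multiplied by `c ^ 2 L ^ 2 ≤ c ^ 2 L` and
integrated; summability of `L` gives a constant independent of the family. -/
theorem exists_isTwoSumming (hI : M.CondI) (hII : M.CondII) {p : Seminorm 𝕜 (KSpace 𝕜 M)}
    {γ : Γ} {m : ℕ} {C : ℝ≥0} (hp : p ≤ C • hilbertSeminorm 𝕜 hI hII γ m) :
    ∃ (γ₁ : Γ) (D : ℝ), 0 ≤ D ∧ ∀ q : Seminorm 𝕜 (KSpace 𝕜 M), kSeminorm 𝕜 M (γ₁, m) ≤ q →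
      IsTwoSumming p q D := by
  obtain ⟨γ₁, L, c, hc, hL0, hL1, hLi, hL⟩ := hI.bounded γ
  have hIL : 0 ≤ ∫ x, L x := integral_nonneg hL0
  set N : ℝ := ((multiIndices k m).card : ℝ)
  refine ⟨γ₁, C ^ 2 * (N * c ^ 2 * ∫ x, L x), by positivity, fun q hq n f K hK h => ?_⟩
  have hint := fun j => integrable_kpIntegrand_two hI hII γ m (f j)
  have hpt : ∀ x, ∑ j, kpIntegrand M 2 γ m (f j).toFun x ≤ N * c ^ 2 * K * L x := by
    intro x
    simp only [kpIntegrand_two]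
    rw [Finset.sum_comm]
    have hterm : ∀ μ ∈ multiIndices k m,
        ∑ j, M γ x ^ 2 * ‖multiDeriv μ (f j).toFun x‖ ^ 2 ≤ c ^ 2 * K * L x := by
      intro μ hμ
      rw [← Finset.mul_sum]
      have h1 := sum_norm_multiDeriv_sq_le hq f hK h x hμ
      calc M γ x ^ 2 * ∑ j, ‖multiDeriv μ (f j).toFun x‖ ^ 2
          ≤ (c * L x * M γ₁ x) ^ 2 * ∑ j, ‖multiDeriv μ (f j).toFun x‖ ^ 2 :=
            mul_le_mul_of_nonneg_right (pow_le_pow_left₀ (M.nonneg _ _) (hL x) 2)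
              (Finset.sum_nonneg fun _ _ => sq_nonneg _)
        _ = c ^ 2 * L x ^ 2 * (M γ₁ x ^ 2 * ∑ j, ‖multiDeriv μ (f j).toFun x‖ ^ 2) := by ring
        _ ≤ c ^ 2 * L x ^ 2 * K := mul_le_mul_of_nonneg_left h1 (by positivity)
        _ ≤ c ^ 2 * L x * K := by
            gcongr
            nlinarith [hL0 x, hL1 x]
        _ = _ := by ring
    calc _ ≤ ∑ _μ ∈ multiIndices k m, c ^ 2 * K * L x := Finset.sum_le_sum hterm
      _ = _ := by rw [Finset.sum_const, nsmul_eq_mul]; ring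
  calc ∑ j, p (f j) ^ 2
      ≤ ∑ j, (C : ℝ) ^ 2 * hilbertSeminorm 𝕜 hI hII γ m (f j) ^ 2 := by
        refine Finset.sum_le_sum fun j _ => ?_
        rw [← mul_pow]
        exact pow_le_pow_left₀ (apply_nonneg p _) (hp (f j)) 2
    _ = C ^ 2 * ∫ x, ∑ j, kpIntegrand M 2 γ m (f j).toFun x := by
        rw [integral_finsetSum _ fun j _ => hint j, ← Finset.mul_sum]
        simp only [hilbertSeminorm_sq]
    _ ≤ C ^ 2 * ∫ x, N * c ^ 2 * K * L x := by
        refine mul_le_mul_of_nonneg_left ?_ (by positivity)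
        exact integral_mono (integrable_finsetSum _ fun j _ => hint j) (hLi.const_mul _) hpt
    _ = _ := by rw [integral_const_mul]; ring

/-- A family of one vector is admissible with `K = q f ^ 2`. -/
theorem IsTwoSumming.le_smul {F : Type*} [AddCommGroup F] [Module 𝕜 F] {p q : Seminorm 𝕜 F}
    {D : ℝ} (hD : 0 ≤ D) (h : IsTwoSumming p q D) (f : F) : p f ≤ √D * q f := by
  have h1 := h 1 (fun _ => f) (q f ^ 2) (sq_nonneg _) fun a => by
    simp only [Fin.sum_univ_one, map_smul_eq_mul]
    exact le_of_eq (by ring)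
  rw [Fin.sum_univ_one] at h1
  refine le_of_sq_le_sq ?_ (by positivity)
  rwa [mul_pow, Real.sq_sqrt hD]

theorem exists_hilbert_isTwoSumming (hI : M.CondI) (hII : M.CondII)
    (p : Seminorm 𝕜 (KSpace 𝕜 M)) (hp : Continuous p) :
    ∃ (q : Seminorm 𝕜 (KSpace 𝕜 M)) (D : ℝ), p ≤ q ∧ Continuous q ∧ IsHilbertSeminorm q ∧
      0 ≤ D ∧ IsTwoSumming p q D := by
  obtain ⟨γ, m, C, hC⟩ := exists_le_hilbertSeminorm hI hII p hp
  obtain ⟨γ₁, D, hD0, hD⟩ := exists_isTwoSumming hI hII hC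
  obtain ⟨γ₂, m₂, C₂, hC₂⟩ := exists_kSeminorm_le_hilbertSeminorm (𝕜 := 𝕜) hI hII (γ₁, m)
  set q₁ := C₂ • hilbertSeminorm 𝕜 hI hII γ₂ m₂
  -- The factor `√D` forces `p ≤ t • q₁`, and the factor `1` keeps `t • q₁` above the supremum
  -- seminorm, so the two-summing constant `D` survives the rescaling.
  let t : ℝ≥0 := max 1 ⟨√D, Real.sqrt_nonneg D⟩
  have hle : ∀ s : ℝ≥0, s ≤ t → ∀ f, s * q₁ f ≤ (t • q₁) f := fun s hs f =>
    mul_le_mul_of_nonneg_right (NNReal.coe_le_coe.2 hs) (apply_nonneg _ _)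
  refine ⟨t • q₁, D, fun f => ?_, ?_, ?_, hD0, hD _ fun f => ?_⟩
  · exact ((hD q₁ hC₂).le_smul hD0 f).trans (hle _ (le_max_right _ _) f)
  · exact ((continuous_hilbertSeminorm hI hII γ₂ m₂).const_smul C₂).const_smul t
  · exact ((isHilbertSeminorm_hilbertSeminorm hI hII γ₂ m₂).smul C₂).smul t
  · refine (hC₂ f).trans ?_
    simpa using hle 1 (le_max_left _ _) f

/-- The dominating seminorm `q` is itself continuous, so the construction applies again to `q`; the
two resulting Hilbert–Schmidt maps compose to a nuclear one. -/
theorem isNuclearSpace_kSpace (hI : M.CondI) (hII : M.CondII) :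
    IsNuclearSpace 𝕜 (KSpace 𝕜 M) where
  locallyConvex := (kSpace_withSeminorms 𝕜 M).toPolynormableSpace
  nuclear p hp := by
    obtain ⟨q, C, hpq, hqc, hqH, hC0, hC⟩ := exists_hilbert_isTwoSumming hI hII p hp
    obtain ⟨r, D, hqr, hrc, hrH, hD0, hD⟩ := exists_hilbert_isTwoSumming hI hII q hqc
    exact ⟨r, hpq.trans hqr, hrc, hC.isNuclearMap hpq hqr hC0 hD0 hD hqH hrH⟩

end NuclearKSpace

theorem lemma3 {𝕜 : Type*} [RCLike 𝕜] {k : ℕ} {Γ : Type*} (M : DefiningFamily k Γ)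
    (hI : M.CondI) (hII : M.CondII) :
    IsNuclearSpace 𝕜 (KSpace 𝕜 M) ∧ IsFrechetSpace 𝕜 (KSpace 𝕜 M) ∧
    ∀ (p : ℝ) (hp : 1 ≤ p),
      KSubmodule 𝕜 M = KpSubmodule 𝕜 M hp ∧
      ∃ e : KSpace 𝕜 M ≃L[𝕜] KpSpace 𝕜 M hp, ∀ f : KSpace 𝕜 M, (e f).toFun = f.toFun :=
  ⟨isNuclearSpace_kSpace hI hII, isFrechetSpace_kSpace, fun _ hp =>
    ⟨KSubmodule_eq_KpSubmodule hI hII hp, kSpaceEquiv 𝕜 hI hII hp, fun _ => rfl⟩⟩
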